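/- A (not necessarily unital) $\mathrm{C}^*$-algebra $A$ is called \emph{soft} if for every proper, closed, two-sided ideal $I\subseteq A$ the quotient $A/I$ is nonunital. For $\mathrm{C}^*$-algebras $A$ and $B$, let $A\odot B$ denote their algebraic tensor product over $\mathbb{C}$ with its natural $*$-algebra structure. A $\mathrm{C}^*$-cross-norm $\varrho$ on $A\odot B$ is a submultiplicative norm with $\varrho(x^*x)=\varrho(x)^2$ for all $x\in A\odot B$ and $\varrho(a\otimes b)=\|a\|\,\|b\|$ for all $a\in A$, $b\in B$; the completion of $A\odot B$ with respect to $\varrho$ is the $\mathrm{C}^*$-algebra $A\otimes_\varrho B$. Further, $A\otimes_{\mathrm{max}}B$ is the completion of $A\odot B$ with respect to the maximal $\mathrm{C}^*$-norm (the largest $\mathrm{C}^*$-seminorm on $A\odot B$), and $A\otimes_{\mathrm{min}}B$ is its completion with respect to the minimal (spatial) $\mathrm{C}^*$-norm $\|x\|_{\mathrm{min}}=\sup_{\pi,\sigma}\|(\pi\otimes\sigma)(x)\|$, where $\pi$ and $\sigma$ range over all $*$-representations of $A$ and $B$, respectively, on Hilbert spaces $H$ and $K$, and $\pi\otimes\sigma$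 acts on the Hilbert space tensor product of $H$ and $K$. \textbf{Proposition.} Let $A$ and $B$ be $\mathrm{C}^*$-algebras. Then the following are equivalent: \begin{enumerate} \item $A$ or $B$ is soft; \item the maximal tensor product $A\otimes_{\mathrm{max}}B$ is soft; \item the tensor product $A\otimes_{\varrho}B$ is soft for some $\mathrm{C}^*$-cross-norm $\varrho$ on $A\odot B$; \item[(3$'$)] the tensor product $A\otimes_{\varrho}B$ is soft for every $\mathrm{C}^*$-cross-norm $\varrho$ on $A\odot B$; \item[(4)] the minimal tensor product $A\otimes_{\mathrm{min}}B$ is soft. \end{enumerate} -/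

import Mathlib

open scoped TensorProduct InnerProductSpace

/-! ### Soft C*-algebras -/

/-- A (possibly nonunital) ring `R` is unital if it has a two-sided multiplicative unit. -/
def IsUnitalRing (R : Type*) [Mul R] : Prop :=
  ∃ e : R, ∀ x : R, e * x = x ∧ x * e = x

/-- A C*-algebra `A` is soft if for every proper, closed, two-sided ideal `I` of `A` (the ideals of
the algebra `A` are the linear ones) the quotient `A / I` is nonunital. -/
def IsSoft (A : Type*) [NonUnitalCStarAlgebra A] : Prop :=
  ∀ I : TwoSidedIdeal A, (∀ (c : ℂ), ∀ x ∈ I, c • x ∈ I) → IsClosed (I : Set A) → I ≠ ⊤ →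
    ¬ IsUnitalRing I.ringCon.Quotient

/-! ### C*-seminorms on `*`-algebras and their completions -/

/-- A C*-seminorm on a complex `*`-algebra: a submultiplicative seminorm `p` such that
`p (x* x) = p(x)²`. -/
structure CStarSeminorm (D : Type*) [NonUnitalRing D] [Module ℂ D] [StarRing D] extends
    Seminorm ℂ D where
  mul_le' : ∀ x y : D, toFun (x * y) ≤ toFun x * toFun y
  star_mul_self' : ∀ x : D, toFun (star x * x) = toFun x ^ 2

namespace CStarSeminorm

section Basic

variable {D : Type*} [NonUnitalRing D] [Module ℂ D] [StarRing D]

noncomputable instance : CoeFun (CStarSeminorm D) fun _ => D → ℝ := ⟨fun p => p.toSeminorm⟩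

theorem nonneg (p : CStarSeminorm D) (x : D) : 0 ≤ p x := apply_nonneg p.toSeminorm x

theorem mul_le (p : CStarSeminorm D) (x y : D) : p (x * y) ≤ p x * p y := p.mul_le' x y

theorem star_mul_self (p : CStarSeminorm D) (x : D) : p (star x * x) = p x ^ 2 :=
  p.star_mul_self' x

theorem le_star (p : CStarSeminorm D) (x : D) : p x ≤ p (star x) := by
  have h := p.mul_le (star x) x
  rw [p.star_mul_self] at h
  rcases (p.nonneg x).eq_or_lt with h0 | h0
  · rw [← h0]; exact p.nonneg _
  · nlinarith

theorem apply_star (p : CStarSeminorm D) (x : D) : p (star x) = p x :=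
  le_antisymm (by simpa using p.le_star (star x)) (p.le_star x)

/-- The C*-seminorm `x ↦ ‖φ x‖` given by a `*`-homomorphism `φ` into a C*-algebra. -/
noncomputable def ofHom {C : Type*} [NonUnitalCStarAlgebra C] (φ : D →⋆ₙₐ[ℂ] C) :
    CStarSeminorm D where
  toFun x := ‖φ x‖
  map_zero' := by simp
  add_le' x y := by simpa using norm_add_le (φ x) (φ y)
  neg' x := by simp
  smul' c x := by simp [norm_smul]
  mul_le' x y := by simpa using norm_mul_le (φ x) (φ y)
  star_mul_self' x := by simp [map_star, CStarRing.norm_star_mul_self, sq]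

@[simp] theorem ofHom_apply {C : Type*} [NonUnitalCStarAlgebra C] (φ : D →⋆ₙₐ[ℂ] C) (x : D) :
    ofHom φ x = ‖φ x‖ := rfl

/-- The pointwise supremum of a pointwise bounded family of C*-seminorms. -/
noncomputable def sup (S : Set (CStarSeminorm D))
    (hS : ∀ x, ∃ M : ℝ, ∀ p ∈ S, p x ≤ M) : CStarSeminorm D :=
  have hb : ∀ x, BddAbove (Set.range fun p : S => p.1 x) := fun x => by
    obtain ⟨M, hM⟩ := hS x
    exact ⟨M, by rintro _ ⟨p, rfl⟩; exact hM p.1 p.2⟩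
  have hn : ∀ x, 0 ≤ ⨆ p : S, p.1 x := fun x => Real.iSup_nonneg fun p => p.1.nonneg x
  { toFun := fun x => ⨆ p : S, p.1 x
    map_zero' := by simp
    add_le' := fun x y => Real.iSup_le (fun p =>
      (map_add_le_add p.1.toSeminorm x y).trans
        (add_le_add (le_ciSup (hb x) p) (le_ciSup (hb y) p))) (add_nonneg (hn x) (hn y))
    neg' := fun x => by simp
    smul' := fun c x => by
      simp only [map_smul_eq_mul]
      exact (Real.mul_iSup_of_nonneg (norm_nonneg c) _).symm
    mul_le' := fun x y => Real.iSup_le (fun p => (p.1.mul_le x y).trans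
      (mul_le_mul (le_ciSup (hb x) p) (le_ciSup (hb y) p) (p.1.nonneg y) (hn x)))
      (mul_nonneg (hn x) (hn y))
    star_mul_self' := fun x => by
      apply le_antisymm
      · refine Real.iSup_le (fun p => ?_) (sq_nonneg _)
        rw [p.1.star_mul_self]
        exact pow_le_pow_left₀ (p.1.nonneg x) (le_ciSup (hb x) p) 2
      · rw [← Real.le_sqrt (hn x) (hn _)]
        refine Real.iSup_le (fun p => ?_) (Real.sqrt_nonneg _)
        rw [Real.le_sqrt (p.1.nonneg x) (hn _), ← p.1.star_mul_self]
        exact le_ciSup (hb (star x * x)) p }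

theorem sup_apply (S : Set (CStarSeminorm D)) (hS : ∀ x, ∃ M : ℝ, ∀ p ∈ S, p x ≤ M) (x : D) :
    sup S hS x = ⨆ p : S, p.1 x := rfl

/-- The `*`-algebra `D`, equipped with the C*-seminorm `p`. -/
def Carrier (_p : CStarSeminorm D) : Type _ := D

variable (p : CStarSeminorm D)

noncomputable instance : NonUnitalRing p.Carrier := inferInstanceAs (NonUnitalRing D)
noncomputable instance : Module ℂ p.Carrier := inferInstanceAs (Module ℂ D)
noncomputable instance : StarRing p.Carrier := inferInstanceAs (StarRing D)
instance [IsScalarTower ℂ D D] : IsScalarTower ℂ p.Carrier p.Carrier :=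
  inferInstanceAs (IsScalarTower ℂ D D)
instance [SMulCommClass ℂ D D] : SMulCommClass ℂ p.Carrier p.Carrier :=
  inferInstanceAs (SMulCommClass ℂ D D)
instance [StarModule ℂ D] : StarModule ℂ p.Carrier := inferInstanceAs (StarModule ℂ D)

noncomputable instance : NonUnitalSeminormedRing p.Carrier where
  __ := (inferInstance : NonUnitalRing p.Carrier)
  norm x := p x
  dist x y := p (-x + y)
  dist_self x := by
    change p.toSeminorm (-x + x) = 0
    rw [neg_add_cancel]
    exact map_zero p.toSeminorm
  dist_comm x y := by
    have h : (-y + x : p.Carrier) = -(-x + y) := by rw [neg_add, neg_neg, add_comm]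
    change p.toSeminorm (-x + y) = p.toSeminorm (-y + x)
    rw [h]
    exact (map_neg_eq_map p.toSeminorm _).symm
  dist_triangle x y z := by
    have h : (-x + z : p.Carrier) = (-x + y) + (-y + z) := by
      rw [add_assoc, add_neg_cancel_left]
    change p.toSeminorm (-x + z) ≤ p.toSeminorm (-x + y) + p.toSeminorm (-y + z)
    rw [h]
    exact map_add_le_add p.toSeminorm _ _
  dist_eq _ _ := rfl
  norm_mul_le := p.mul_le

noncomputable instance : NormedSpace ℂ p.Carrier where
  norm_smul_le c x := (map_smul_eq_mul p.toSeminorm c x).le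

instance : NormedStarGroup p.Carrier where
  norm_star_le x := (p.apply_star x).le

/-- The element `x` of the `*`-algebra `D`, viewed in `D` equipped with `p`. -/
def toCarrier (x : D) : p.Carrier := x

theorem norm_toCarrier (x : D) : ‖p.toCarrier x‖ = p x := rfl

end Basic

section Completion

open UniformSpace UniformSpace.Completion

variable {D : Type*} [NonUnitalRing D] [Module ℂ D] [StarRing D] (p : CStarSeminorm D)

/-- The multiplication of the completion is the continuous extension of that of `D`. -/
noncomputable instance : Mul (UniformSpace.Completion p.Carrier) :=
  ⟨Function.curry <| (isDenseInducing_coe.prodMap isDenseInducing_coe).extend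
    (((↑) : p.Carrier → (UniformSpace.Completion p.Carrier)) ∘ Function.uncurry (· * ·))⟩

theorem coe_mul (a b : p.Carrier) : ((a * b : p.Carrier) : (UniformSpace.Completion p.Carrier)) = a * b :=
  ((isDenseInducing_coe.prodMap isDenseInducing_coe).extend_eq
      ((continuous_coe p.Carrier).comp (@continuous_mul p.Carrier _ _ _)) (a, b)).symm

instance : ContinuousMul (UniformSpace.Completion p.Carrier) where
  continuous_mul := by
    let m := (AddMonoidHom.mul : p.Carrier →+ p.Carrier →+ p.Carrier).compr₂ toCompl
    have : Continuous fun x : p.Carrier × p.Carrier => m x.1 x.2 :=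
      (continuous_coe p.Carrier).comp continuous_mul
    have di : IsDenseInducing (toCompl : p.Carrier → (UniformSpace.Completion p.Carrier)) := isDenseInducing_coe
    exact (di.extend_Z_bilin di this :)

noncomputable instance : NonUnitalNormedRing (UniformSpace.Completion p.Carrier) where
  __ := (inferInstance : NormedAddCommGroup (UniformSpace.Completion p.Carrier))
  __ := (inferInstance : Mul (UniformSpace.Completion p.Carrier))
  zero_mul a := by
    induction a using induction_on with
    | hp => exact isClosed_eq (by fun_prop) (by fun_prop)
    | ih a => rw [← coe_zero, ← coe_mul, zero_mul]
  mul_zero a := by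
    induction a using induction_on with
    | hp => exact isClosed_eq (by fun_prop) (by fun_prop)
    | ih a => rw [← coe_zero, ← coe_mul, mul_zero]
  mul_assoc a b c := by
    induction a, b, c using induction_on₃ with
    | hp => exact isClosed_eq (by fun_prop) (by fun_prop)
    | ih a b c => rw [← coe_mul, ← coe_mul, ← coe_mul, ← coe_mul, mul_assoc]
  left_distrib a b c := by
    induction a, b, c using induction_on₃ with
    | hp => exact isClosed_eq (by fun_prop) (by fun_prop)
    | ih a b c => rw [← coe_add, ← coe_mul, ← coe_mul, ← coe_mul, ← coe_add, mul_add]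
  right_distrib a b c := by
    induction a, b, c using induction_on₃ with
    | hp => exact isClosed_eq (by fun_prop) (by fun_prop)
    | ih a b c => rw [← coe_add, ← coe_mul, ← coe_mul, ← coe_mul, ← coe_add, add_mul]
  norm_mul_le a b := by
    induction a, b using induction_on₂ with
    | hp => exact isClosed_le (by fun_prop) (by fun_prop)
    | ih a b => simpa only [← coe_mul, norm_coe] using norm_mul_le a b

/-- The involution of the completion is the continuous extension of that of `D`. -/
noncomputable instance : Star (UniformSpace.Completion p.Carrier) := ⟨UniformSpace.Completion.map star⟩

theorem uniformContinuous_star : UniformContinuous (star : p.Carrier → p.Carrier) :=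
  (starNormedAddGroupHom : NormedAddGroupHom p.Carrier p.Carrier).uniformContinuous

theorem coe_star (a : p.Carrier) : ((star a : p.Carrier) : (UniformSpace.Completion p.Carrier)) = star (a : (UniformSpace.Completion p.Carrier)) :=
  (map_coe p.uniformContinuous_star a).symm

instance : ContinuousStar (UniformSpace.Completion p.Carrier) := ⟨continuous_map⟩

noncomputable instance : StarRing (UniformSpace.Completion p.Carrier) where
  star_involutive a := by
    induction a using induction_on with
    | hp => exact isClosed_eq (by fun_prop) (by fun_prop)
    | ih a => rw [← coe_star, ← coe_star, star_star]
  star_mul a b := by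
    induction a, b using induction_on₂ with
    | hp => exact isClosed_eq (by fun_prop) (by fun_prop)
    | ih a b => rw [← coe_star, ← coe_star, ← coe_mul, ← coe_mul, ← coe_star, star_mul]
  star_add a b := by
    induction a, b using induction_on₂ with
    | hp => exact isClosed_eq (by fun_prop) (by fun_prop)
    | ih a b => rw [← coe_star, ← coe_star, ← coe_add, ← coe_add, ← coe_star, star_add]

theorem completion_smul_mul [IsScalarTower ℂ D D] (c : ℂ) (a b : UniformSpace.Completion p.Carrier) :
    c • a * b = c • (a * b) := by
  induction a, b using induction_on₂ with
  | hp =>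
    exact isClosed_eq (((continuous_const_smul c).comp continuous_fst).mul continuous_snd)
      ((continuous_const_smul c).comp (continuous_fst.mul continuous_snd))
  | ih a b => rw [← coe_smul, ← coe_mul, ← coe_mul, ← coe_smul, smul_mul_assoc]

theorem completion_mul_smul [SMulCommClass ℂ D D] (c : ℂ) (a b : UniformSpace.Completion p.Carrier) :
    a * c • b = c • (a * b) := by
  induction a, b using induction_on₂ with
  | hp =>
    exact isClosed_eq (continuous_fst.mul ((continuous_const_smul c).comp continuous_snd))
      ((continuous_const_smul c).comp (continuous_fst.mul continuous_snd))
  | ih a b => rw [← coe_smul, ← coe_mul, ← coe_mul, ← coe_smul, mul_smul_comm]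

theorem completion_star_smul [StarModule ℂ D] (c : ℂ) (a : UniformSpace.Completion p.Carrier) :
    star (c • a) = star c • star a := by
  induction a using induction_on with
  | hp =>
    exact isClosed_eq (continuous_star.comp (continuous_const_smul c))
      ((continuous_const_smul (star c)).comp continuous_star)
  | ih a => rw [← coe_star, ← coe_smul, ← coe_smul, ← coe_star, star_smul]

theorem completion_norm_mul_self_le (a : UniformSpace.Completion p.Carrier) :
    ‖a‖ * ‖a‖ ≤ ‖star a * a‖ := by
  induction a using induction_on with
  | hp => exact isClosed_le (by fun_prop) (by fun_prop)
  | ih a =>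
    rw [← coe_star, ← coe_mul, norm_coe, norm_coe]
    exact ((p.star_mul_self a).trans (sq _)).ge

noncomputable instance [IsScalarTower ℂ D D] [SMulCommClass ℂ D D] [StarModule ℂ D] :
    NonUnitalCStarAlgebra (UniformSpace.Completion p.Carrier) where
  norm_mul_self_le := p.completion_norm_mul_self_le
  norm_smul_le := norm_smul_le
  smul_assoc := p.completion_smul_mul
  smul_comm c a b := (p.completion_mul_smul c a b).symm
  star_smul := p.completion_star_smul

/-- The (Hausdorff) completion of `D` with respect to the C*-seminorm `p`. -/
def Completion {D : Type*} [NonUnitalRing D] [Module ℂ D] [StarRing D] (p : CStarSeminorm D) :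
    Type _ :=
  UniformSpace.Completion p.Carrier

variable [IsScalarTower ℂ D D] [SMulCommClass ℂ D D] [StarModule ℂ D]

/-- The completion of a complex `*`-algebra with respect to a C*-seminorm is a C*-algebra. -/
noncomputable instance : NonUnitalCStarAlgebra p.Completion :=
  inferInstanceAs (NonUnitalCStarAlgebra (UniformSpace.Completion p.Carrier))

/-- The canonical `*`-homomorphism from `D` to its completion. -/
noncomputable def toCompletion : D →⋆ₙₐ[ℂ] p.Completion where
  toFun x := (p.toCarrier x : UniformSpace.Completion p.Carrier)
  map_smul' c x := coe_smul c (p.toCarrier x)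
  map_zero' := coe_zero
  map_add' x y := coe_add (p.toCarrier x) (p.toCarrier y)
  map_mul' x y := p.coe_mul (p.toCarrier x) (p.toCarrier y)
  map_star' x := p.coe_star (p.toCarrier x)

theorem norm_toCompletion (x : D) : ‖p.toCompletion x‖ = p x := norm_coe (p.toCarrier x)

theorem denseRange_toCompletion : DenseRange p.toCompletion :=
  UniformSpace.Completion.denseRange_coe (α := p.Carrier)

end Completion

end CStarSeminorm

/-! ### C*-tensor products -/

namespace CStarTensor

/-- A positive contraction in a C*-algebra dominates its square. -/
theorem mul_self_le_self {A : Type*} [NonUnitalCStarAlgebra A] [PartialOrder A]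
    [StarOrderedRing A] {a : A} (ha : 0 ≤ a) (ha1 : ‖a‖ ≤ 1) : a * a ≤ a := by
  obtain ⟨x, rfl⟩ := CStarAlgebra.nonneg_iff_eq_star_mul_self.mp ha
  have h := CStarAlgebra.star_left_conjugate_le_norm_smul (a := x) (b := x * star x)
    (IsSelfAdjoint.mul_star_self x)
  have hn : ‖x * star x‖ ≤ 1 := by
    rwa [CStarRing.norm_self_mul_star, ← CStarRing.norm_star_mul_self]
  calc star x * x * (star x * x) = star x * (x * star x) * x := by simp only [mul_assoc]
    _ ≤ ‖x * star x‖ • (star x * x) := h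
    _ ≤ (1 : ℝ) • (star x * x) := smul_le_smul_of_nonneg_right hn ha
    _ = star x * x := one_smul _ _

variable {A B : Type*} [NonUnitalCStarAlgebra A] [NonUnitalCStarAlgebra B]

theorem norm_hom_tmul_le_one {C : Type*} [NonUnitalCStarAlgebra C] (φ : (A ⊗[ℂ] B) →⋆ₙₐ[ℂ] C)
    {a : A} {b : B} (ha : ‖a‖ ≤ 1) (hb : ‖b‖ ≤ 1) : ‖φ (a ⊗ₜ b)‖ ≤ 1 := by
  let _ := CStarAlgebra.spectralOrder A
  let _ := CStarAlgebra.spectralOrderedRing A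
  let _ := CStarAlgebra.spectralOrder B
  let _ := CStarAlgebra.spectralOrderedRing B
  let _ := CStarAlgebra.spectralOrder C
  let _ := CStarAlgebra.spectralOrderedRing C
  have hpos : ∀ (c : A) (d : B), 0 ≤ c → 0 ≤ d → 0 ≤ φ (c ⊗ₜ d) := by
    intro c d hc hd
    obtain ⟨x, rfl⟩ := CStarAlgebra.nonneg_iff_eq_star_mul_self.mp hc
    obtain ⟨y, rfl⟩ := CStarAlgebra.nonneg_iff_eq_star_mul_self.mp hd
    have : (star x * x) ⊗ₜ[ℂ] (star y * y) = star (x ⊗ₜ[ℂ] y) * (x ⊗ₜ[ℂ] y) := by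
      simp [TensorProduct.star_tmul, Algebra.TensorProduct.tmul_mul_tmul]
    rw [this, map_mul, map_star]
    exact star_mul_self_nonneg _
  have key : ∀ (c : A) (d : B), 0 ≤ c → 0 ≤ d → ‖c‖ ≤ 1 → ‖d‖ ≤ 1 → ‖φ (c ⊗ₜ d)‖ ≤ 1 := by
    intro c d hc hd hc1 hd1
    have h0 := hpos c d hc hd
    have h1 := hpos (c - c * c) d (sub_nonneg.mpr (mul_self_le_self hc hc1)) hd
    have hcc : 0 ≤ c * c := by
      have := star_mul_self_nonneg c
      rwa [(IsSelfAdjoint.of_nonneg hc).star_eq] at this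
    have h2 := hpos (c * c) (d - d * d) hcc (sub_nonneg.mpr (mul_self_le_self hd hd1))
    have hle : φ (c ⊗ₜ d) * φ (c ⊗ₜ d) ≤ φ (c ⊗ₜ d) := by
      rw [← sub_nonneg]
      have h3 := add_nonneg h1 h2
      rw [TensorProduct.sub_tmul, TensorProduct.tmul_sub, map_sub, map_sub,
        sub_add_sub_cancel] at h3
      rwa [← map_mul, Algebra.TensorProduct.tmul_mul_tmul]
    have hsa := (IsSelfAdjoint.of_nonneg h0).star_eq
    have hsq : 0 ≤ φ (c ⊗ₜ d) * φ (c ⊗ₜ d) := by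
      have := star_mul_self_nonneg (φ (c ⊗ₜ d))
      rwa [hsa] at this
    have hn := CStarAlgebra.norm_le_norm_of_nonneg_of_le hsq hle
    have hs := CStarRing.norm_star_mul_self (x := φ (c ⊗ₜ d))
    rw [hsa] at hs
    rw [hs] at hn
    by_contra! hlt
    nlinarith
  have h := key (star a * a) (star b * b) (star_mul_self_nonneg a) (star_mul_self_nonneg b)
    (by rw [CStarRing.norm_star_mul_self]; nlinarith [norm_nonneg a])
    (by rw [CStarRing.norm_star_mul_self]; nlinarith [norm_nonneg b])
  have he : (star a * a) ⊗ₜ[ℂ] (star b * b) = star (a ⊗ₜ[ℂ] b) * (a ⊗ₜ[ℂ] b) := by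
    simp [TensorProduct.star_tmul, Algebra.TensorProduct.tmul_mul_tmul]
  rw [he, map_mul, map_star, CStarRing.norm_star_mul_self] at h
  by_contra! hlt
  nlinarith

/-- Every C*-seminorm on the algebraic tensor product is subcross. -/
theorem seminorm_tmul_le (p : CStarSeminorm (A ⊗[ℂ] B)) (a : A) (b : B) :
    p (a ⊗ₜ b) ≤ ‖a‖ * ‖b‖ := by
  rcases eq_or_ne a 0 with rfl | ha
  · simp
  rcases eq_or_ne b 0 with rfl | hb
  · simp
  have ha' : ‖a‖ ≠ 0 := norm_ne_zero_iff.mpr ha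
  have hb' : ‖b‖ ≠ 0 := norm_ne_zero_iff.mpr hb
  have h := norm_hom_tmul_le_one p.toCompletion
    (a := ((‖a‖ : ℂ)⁻¹) • a) (b := ((‖b‖ : ℂ)⁻¹) • b)
    (by simp [norm_smul, ha']) (by simp [norm_smul, hb'])
  rw [p.norm_toCompletion, TensorProduct.smul_tmul_smul, map_smul_eq_mul, norm_mul, norm_inv,
    norm_inv, Complex.norm_real, Complex.norm_real, norm_norm, norm_norm] at h
  have h2 : 0 < ‖a‖ * ‖b‖ := by positivity
  rwa [← mul_inv, inv_mul_le_iff₀ h2, mul_one] at h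

theorem seminorm_bounded (S : Set (CStarSeminorm (A ⊗[ℂ] B))) (x : A ⊗[ℂ] B) :
    ∃ M : ℝ, ∀ p ∈ S, p x ≤ M := by
  induction x using TensorProduct.induction_on with
  | zero => exact ⟨0, fun p _ => by simp⟩
  | tmul a b => exact ⟨‖a‖ * ‖b‖, fun p _ => seminorm_tmul_le p a b⟩
  | add x y hx hy =>
    obtain ⟨M, hM⟩ := hx
    obtain ⟨N, hN⟩ := hy
    exact ⟨M + N, fun p hp =>
      (map_add_le_add p.toSeminorm x y).trans (add_le_add (hM p hp) (hN p hp))⟩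

section Spatial

open UniformSpace UniformSpace.Completion

variable {H K : Type*} [NormedAddCommGroup H] [InnerProductSpace ℂ H]
  [NormedAddCommGroup K] [InnerProductSpace ℂ K]

variable (H K) in
/-- The Hilbert space tensor product of `H` and `K`: the completion of the algebraic tensor product
with respect to the inner product `⟪ξ ⊗ η, ξ' ⊗ η'⟫ = ⟪ξ, ξ'⟫ * ⟪η, η'⟫`. -/
def HilbertTensor : Type _ := Completion (H ⊗[ℂ] K)

noncomputable instance : NormedAddCommGroup (HilbertTensor H K) :=
  inferInstanceAs (NormedAddCommGroup (Completion (H ⊗[ℂ] K)))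

noncomputable instance : InnerProductSpace ℂ (HilbertTensor H K) :=
  inferInstanceAs (InnerProductSpace ℂ (Completion (H ⊗[ℂ] K)))

instance : CompleteSpace (HilbertTensor H K) :=
  inferInstanceAs (CompleteSpace (Completion (H ⊗[ℂ] K)))

/-- The canonical isometric embedding of the algebraic tensor product. -/
noncomputable def toHilbert : (H ⊗[ℂ] K) →ₗᵢ[ℂ] HilbertTensor H K :=
  (toComplₗᵢ : (H ⊗[ℂ] K) →ₗᵢ[ℂ] Completion (H ⊗[ℂ] K))

theorem denseRange_toHilbert :
    DenseRange (toHilbert : (H ⊗[ℂ] K) →ₗᵢ[ℂ] HilbertTensor H K) :=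
  denseRange_coe (α := H ⊗[ℂ] K)

/-- The operator `S ⊗ T` on the Hilbert space tensor product of `H` and `K`. -/
noncomputable def hilbertTmul (S : H →L[ℂ] H) (T : K →L[ℂ] K) :
    HilbertTensor H K →L[ℂ] HilbertTensor H K :=
  (TensorProduct.mapL S T).completion

theorem hilbertTmul_coe (S : H →L[ℂ] H) (T : K →L[ℂ] K) (x : H ⊗[ℂ] K) :
    hilbertTmul S T (toHilbert x) = toHilbert (TensorProduct.mapL S T x) :=
  ContinuousLinearMap.completion_apply_coe _ _

theorem hilbert_ext {S T : HilbertTensor H K →L[ℂ] HilbertTensor H K}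
    (h : ∀ x : H ⊗[ℂ] K, S (toHilbert x) = T (toHilbert x)) : S = T :=
  DFunLike.coe_injective (denseRange_toHilbert.equalizer S.continuous T.continuous (funext h))

theorem hilbertTmul_mul (S S' : H →L[ℂ] H) (T T' : K →L[ℂ] K) :
    hilbertTmul (S * S') (T * T') = hilbertTmul S T * hilbertTmul S' T' :=
  hilbert_ext fun x => by
    rw [mul_apply_eq_comp, hilbertTmul_coe, hilbertTmul_coe, hilbertTmul_coe,
      TensorProduct.mapL_mul, mul_apply_eq_comp]

theorem hilbertTmul_star [CompleteSpace H] [CompleteSpace K] (S : H →L[ℂ] H) (T : K →L[ℂ] K) :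
    hilbertTmul (star S) (star T) = star (hilbertTmul S T) := by
  refine (ContinuousLinearMap.eq_adjoint_iff _ _).mpr fun x y => ?_
  refine denseRange_toHilbert.induction_on₂ (p := fun x y =>
    inner ℂ (hilbertTmul (star S) (star T) x) y = inner ℂ x (hilbertTmul S T y))
    (isClosed_eq (by fun_prop) (by fun_prop)) (fun x y => ?_) x y
  rw [hilbertTmul_coe, hilbertTmul_coe, LinearIsometry.inner_map_map, LinearIsometry.inner_map_map]
  induction x using TensorProduct.induction_on with
  | zero => simp
  | add x₁ x₂ h₁ h₂ => rw [map_add, inner_add_left, inner_add_left, h₁, h₂]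
  | tmul ξ η =>
    induction y using TensorProduct.induction_on with
    | zero => simp
    | add y₁ y₂ h₁ h₂ => rw [map_add, inner_add_right, inner_add_right, h₁, h₂]
    | tmul ξ' η' =>
      simp [ContinuousLinearMap.star_eq_adjoint, ContinuousLinearMap.adjoint_inner_left]

/-- `(S, T) ↦ S ⊗ T` as a bilinear map. -/
noncomputable def hilbertTmulBilin : (H →L[ℂ] H) →ₗ[ℂ] (K →L[ℂ] K) →ₗ[ℂ]
    (HilbertTensor H K →L[ℂ] HilbertTensor H K) :=
  LinearMap.mk₂ ℂ hilbertTmul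
    (fun S S' T => hilbert_ext fun x => by
      rw [add_apply, hilbertTmul_coe, hilbertTmul_coe, hilbertTmul_coe,
        TensorProduct.mapL_add_left, add_apply, map_add])
    (fun c S T => hilbert_ext fun x => by
      rw [smul_apply, hilbertTmul_coe, hilbertTmul_coe,
        TensorProduct.mapL_smul_left, smul_apply, map_smul])
    (fun S T T' => hilbert_ext fun x => by
      rw [add_apply, hilbertTmul_coe, hilbertTmul_coe, hilbertTmul_coe,
        TensorProduct.mapL_add_right, add_apply, map_add])
    (fun c S T => hilbert_ext fun x => by
      rw [smul_apply, hilbertTmul_coe, hilbertTmul_coe,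
        TensorProduct.mapL_smul_right, smul_apply, map_smul])

/-- The representation `π ⊗ σ` of the algebraic tensor product of `A` and `B` on the Hilbert space
tensor product of `H` and `K`, `(π ⊗ σ)(a ⊗ b) = π(a) ⊗ σ(b)`. -/
noncomputable def tensorRep [CompleteSpace H] [CompleteSpace K] (π : A →⋆ₙₐ[ℂ] (H →L[ℂ] H)) (σ : B →⋆ₙₐ[ℂ] (K →L[ℂ] K)) :
    (A ⊗[ℂ] B) →⋆ₙₐ[ℂ] (HilbertTensor H K →L[ℂ] HilbertTensor H K) :=
  let L : (A ⊗[ℂ] B) →ₗ[ℂ] (HilbertTensor H K →L[ℂ] HilbertTensor H K) :=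
    TensorProduct.lift (hilbertTmulBilin.compl₁₂
      ((π : A →ₙₐ[ℂ] (H →L[ℂ] H)) : A →ₗ[ℂ] (H →L[ℂ] H))
      ((σ : B →ₙₐ[ℂ] (K →L[ℂ] K)) : B →ₗ[ℂ] (K →L[ℂ] K)))
  have hL : ∀ a b, L (a ⊗ₜ b) = hilbertTmul (π a) (σ b) := fun _ _ => rfl
  { toFun := L
    map_smul' := fun c x => map_smul L c x
    map_zero' := map_zero L
    map_add' := map_add L
    map_mul' := fun x y => by
      induction x using TensorProduct.induction_on with
      | zero => simp
      | add x₁ x₂ h₁ h₂ => rw [add_mul, map_add, map_add, add_mul, h₁, h₂]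
      | tmul a b =>
        induction y using TensorProduct.induction_on with
        | zero => simp
        | add y₁ y₂ h₁ h₂ => rw [mul_add, map_add, map_add, mul_add, h₁, h₂]
        | tmul a' b' =>
          rw [Algebra.TensorProduct.tmul_mul_tmul, hL, hL, hL, map_mul, map_mul, hilbertTmul_mul]
    map_star' := fun x => by
      induction x using TensorProduct.induction_on with
      | zero => simp
      | add x₁ x₂ h₁ h₂ => rw [star_add, map_add, map_add, star_add, h₁, h₂]
      | tmul a b => rw [TensorProduct.star_tmul, hL, hL, map_star, map_star, hilbertTmul_star] }

theorem tensorRep_tmul [CompleteSpace H] [CompleteSpace K] (π : A →⋆ₙₐ[ℂ] (H →L[ℂ] H)) (σ : B →⋆ₙₐ[ℂ] (K →L[ℂ] K)) (a : A) (b : B) :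
    tensorRep π σ (a ⊗ₜ b) = hilbertTmul (π a) (σ b) := rfl

end Spatial

end CStarTensor

/-- The maximal C*-norm on the algebraic tensor product of `A` and `B`: the largest C*-seminorm. -/
noncomputable def maxTensorNorm (A B : Type*) [NonUnitalCStarAlgebra A]
    [NonUnitalCStarAlgebra B] : CStarSeminorm (A ⊗[ℂ] B) :=
  CStarSeminorm.sup Set.univ (CStarTensor.seminorm_bounded _)

/-- The minimal (spatial) C*-norm on the algebraic tensor product of `A` and `B`: the supremum of
`‖(π ⊗ σ)(x)‖` over all representations `π` of `A` and `σ` of `B` on Hilbert spaces. -/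
noncomputable def minTensorNorm.{u, v} (A : Type u) (B : Type v) [NonUnitalCStarAlgebra A]
    [NonUnitalCStarAlgebra B] : CStarSeminorm (A ⊗[ℂ] B) :=
  CStarSeminorm.sup
    {p | ∃ (H : Type u) (_ : NormedAddCommGroup H) (_ : InnerProductSpace ℂ H)
      (_ : CompleteSpace H) (K : Type v) (_ : NormedAddCommGroup K) (_ : InnerProductSpace ℂ K)
      (_ : CompleteSpace K) (π : A →⋆ₙₐ[ℂ] (H →L[ℂ] H)) (σ : B →⋆ₙₐ[ℂ] (K →L[ℂ] K)),
      p = CStarSeminorm.ofHom (CStarTensor.tensorRep π σ)}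
    (CStarTensor.seminorm_bounded _)

/-- A C*-cross-norm on the algebraic tensor product of `A` and `B`: a C*-norm `ϱ` with
`ϱ(a ⊗ b) = ‖a‖ ‖b‖`. -/
structure CStarCrossNorm (A B : Type*) [NonUnitalCStarAlgebra A] [NonUnitalCStarAlgebra B] extends
    CStarSeminorm (A ⊗[ℂ] B) where
  eq_zero_of_apply_eq_zero : ∀ x, toCStarSeminorm x = 0 → x = 0
  apply_tmul : ∀ (a : A) (b : B), toCStarSeminorm (a ⊗ₜ b) = ‖a‖ * ‖b‖

/-- The maximal tensor product of `A` and `B`. -/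
abbrev MaxTensorProduct (A B : Type*) [NonUnitalCStarAlgebra A] [NonUnitalCStarAlgebra B] :
    Type _ :=
  (maxTensorNorm A B).Completion

/-- The minimal tensor product of `A` and `B`. -/
abbrev MinTensorProduct (A B : Type*) [NonUnitalCStarAlgebra A] [NonUnitalCStarAlgebra B] :
    Type _ :=
  (minTensorNorm A B).Completion

/-- The completion of the algebraic tensor product of `A` and `B` with respect to the C*-cross-norm
`ϱ`. -/
abbrev CStarCrossNorm.TensorProduct {A B : Type*} [NonUnitalCStarAlgebra A]
    [NonUnitalCStarAlgebra B] (ϱ : CStarCrossNorm A B) : Type _ :=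
  ϱ.toCStarSeminorm.Completion

/-! A quotient by `I` is unital exactly when `I` is modular: some `e` satisfies `ex - x ∈ I` and `xe
- x ∈ I` for all `x`. Softness therefore says that no proper closed ideal is modular. The proof
moves modular ideals between the factors and the product and never identifies a quotient of the
product.

From the product to a factor (`isSoft_of_multiplicative`): let `u` be a unit modulo a proper closed
ideal `J` of the completion. Some `a₀ ⊗ b₀` with positive contractions `a₀`, `b₀` moves `u` by less
than `1/2`, so multiplication by it at most halves the distance to `J`. On the part of the spectrum
below `1/4` the powers of `a₀` decay like `4⁻ⁿ`, which beats the loss `2ⁿ`; hence a cut-off `e =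
f(a₀)` is a unit modulo `{a | a ⊗ B ⊆ J}`. This works for every C*-seminorm, since all of them are
subcross.

From both factors to the product (`not_isSoft_of_multiplicative`): if `e`, `f` are units modulo `I`,
`J`, then `e ⊗ f` is a unit modulo the closure `K` of `I ⊙ B + A ⊙ J`. The point is that `K` is
proper. Approximate units of `I` and `J` yield bounded `v`, `w` that asymptotically annihilate `I`,
`J`, while `‖ve‖, ‖wf‖ ≥ 1`. So `v ⊗ w` asymptotically annihilates `K`, but the cross property keeps
`‖(v ⊗ w)(e ⊗ f)‖ ≥ 1`.

It remains to see that the minimal norm is a C*-cross-norm, which follows from GNS representations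
of norming states, and that the maximal norm, which dominates it, is cross as well. -/

/-! ### Unital quotients -/

/-- The quotient by a two-sided ideal is unital iff the ideal is modular. -/
theorem TwoSidedIdeal.isUnitalRing_quotient_iff {R : Type*} [NonUnitalRing R]
    (I : TwoSidedIdeal R) :
    IsUnitalRing I.ringCon.Quotient ↔ ∃ e : R, ∀ x : R, e * x - x ∈ I ∧ x * e - x ∈ I := by
  have key : ∀ e x : R, ((e : I.ringCon.Quotient) * (x : I.ringCon.Quotient) = x ∧
      (x : I.ringCon.Quotient) * (e : I.ringCon.Quotient) = x) ↔
      (e * x - x ∈ I ∧ x * e - x ∈ I) := fun e x => by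
    rw [← RingCon.coe_mul, ← RingCon.coe_mul, RingCon.eq, RingCon.eq, I.rel_iff, I.rel_iff]
  constructor
  · rintro ⟨e, he⟩
    obtain ⟨e, rfl⟩ := Quotient.exists_rep e
    exact ⟨e, fun x => (key e x).1 (he x)⟩
  · rintro ⟨e, he⟩
    refine ⟨(e : I.ringCon.Quotient), fun x => ?_⟩
    obtain ⟨x, rfl⟩ := Quotient.exists_rep x
    exact (key e x).2 (he x)

theorem not_isSoft_iff {A : Type*} [NonUnitalCStarAlgebra A] :
    ¬ IsSoft A ↔ ∃ I : TwoSidedIdeal A, (∀ (c : ℂ), ∀ x ∈ I, c • x ∈ I) ∧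
      IsClosed (I : Set A) ∧ I ≠ ⊤ ∧ ∃ e : A, ∀ x : A, e * x - x ∈ I ∧ x * e - x ∈ I := by
  simp only [IsSoft, TwoSidedIdeal.isUnitalRing_quotient_iff]
  push Not
  rfl

theorem TwoSidedIdeal.eq_top_of_modularUnit_mem {R : Type*} [NonUnitalRing R]
    {I : TwoSidedIdeal R} {e : R} (he : ∀ x : R, e * x - x ∈ I ∧ x * e - x ∈ I) (h : e ∈ I) :
    I = ⊤ := by
  refine TwoSidedIdeal.ext fun x => ⟨fun _ => TwoSidedIdeal.mem_top R, fun _ => ?_⟩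
  have := I.sub_mem (I.mul_mem_right e x h) (he x).1
  rwa [sub_sub_cancel] at this

/-! ### The quotient seminorm of a two-sided ideal -/

section QuotientSeminorm

variable {D : Type*} [NonUnitalNormedRing D] (J : TwoSidedIdeal D)

/-- The quotient seminorm `x ↦ dist(x, J)`. -/
noncomputable def TwoSidedIdeal.quotNorm (x : D) : ℝ :=
  ‖(x : D ⧸ AddSubgroup.ofClass J)‖

namespace TwoSidedIdeal

theorem quotNorm_nonneg (x : D) : 0 ≤ J.quotNorm x := norm_nonneg _

theorem quotNorm_le_norm (x : D) : J.quotNorm x ≤ ‖x‖ := QuotientAddGroup.norm_mk_le_norm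

theorem quotNorm_add_le (x y : D) : J.quotNorm (x + y) ≤ J.quotNorm x + J.quotNorm y :=
  norm_add_le (x : D ⧸ AddSubgroup.ofClass J) (y : D ⧸ AddSubgroup.ofClass J)

theorem quotNorm_eq_of_sub_mem {x y : D} (h : x - y ∈ J) : J.quotNorm x = J.quotNorm y := by
  unfold quotNorm
  congr 1
  rw [QuotientAddGroup.eq]
  change -x + y ∈ J
  have := J.neg_mem h
  rwa [neg_sub, sub_eq_neg_add] at this

theorem quotNorm_neg (x : D) : J.quotNorm (-x) = J.quotNorm x :=
  norm_neg (x : D ⧸ AddSubgroup.ofClass J)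

theorem exists_norm_lt_of_quotNorm_lt {x : D} {r : ℝ} (h : J.quotNorm x < r) :
    ∃ y, x - y ∈ J ∧ ‖y‖ < r := by
  obtain ⟨m, hm, hr⟩ := QuotientAddGroup.norm_lt_iff.1 h
  refine ⟨m, ?_, hr⟩
  rw [QuotientAddGroup.eq] at hm
  change -m + x ∈ J at hm
  rwa [sub_eq_neg_add]

theorem quotNorm_mul_le (x y : D) : J.quotNorm (x * y) ≤ J.quotNorm x * J.quotNorm y := by
  -- The distance to `J` is only approximated by representatives, so the bound is shown for all
  -- larger `r`, `s`, which then decrease to the two distances.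
  have key : ∀ r > J.quotNorm x, ∀ s > J.quotNorm y, J.quotNorm (x * y) ≤ r * s := by
    intro r hr s hs
    obtain ⟨x', hx, hxr⟩ := J.exists_norm_lt_of_quotNorm_lt hr
    obtain ⟨y', hy, hys⟩ := J.exists_norm_lt_of_quotNorm_lt hs
    have h : x * y - x' * y' ∈ J := by
      have := J.add_mem (J.mul_mem_right _ y hx) (J.mul_mem_left x' _ hy)
      rwa [sub_mul, mul_sub, sub_add_sub_cancel] at this
    rw [J.quotNorm_eq_of_sub_mem h]
    calc J.quotNorm (x' * y') ≤ ‖x'‖ * ‖y'‖ := (J.quotNorm_le_norm _).trans (norm_mul_le _ _)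
      _ ≤ r * s := mul_le_mul hxr.le hys.le (norm_nonneg _) ((norm_nonneg _).trans hxr.le)
  have h1 : ∀ r > J.quotNorm x, J.quotNorm (x * y) ≤ r * J.quotNorm y := fun r hr =>
    ge_of_tendsto ((continuous_const_mul r).continuousWithinAt.tendsto (s := Set.Ioi _))
      (Filter.eventually_of_mem self_mem_nhdsWithin (key r hr))
  exact ge_of_tendsto ((continuous_mul_const _).continuousWithinAt.tendsto (s := Set.Ioi _))
      (Filter.eventually_of_mem self_mem_nhdsWithin h1)

theorem quotNorm_eq_zero_iff (hJ : IsClosed (J : Set D)) {x : D} : J.quotNorm x = 0 ↔ x ∈ J :=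
  QuotientAddGroup.norm_mk_eq_zero (S := AddSubgroup.ofClass J) (hS := hJ)

/-- A modular unit is idempotent modulo `J`, so its quotient norm `q` satisfies `q ≤ q²`; and `q ≠
0`, as otherwise `e ∈ J`. -/
theorem one_le_quotNorm_of_modularUnit (hJ : IsClosed (J : Set D)) (hJ' : J ≠ ⊤) {e : D}
    (he : ∀ x : D, e * x - x ∈ J ∧ x * e - x ∈ J) : 1 ≤ J.quotNorm e := by
  have h0 : 0 < J.quotNorm e := (J.quotNorm_nonneg e).lt_of_ne fun h =>
    hJ' (eq_top_of_modularUnit_mem he ((J.quotNorm_eq_zero_iff hJ).1 h.symm))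
  have h := J.quotNorm_mul_le e e
  rw [J.quotNorm_eq_of_sub_mem (he e).1] at h
  exact le_of_mul_le_mul_left (by simpa using h) h0

end TwoSidedIdeal

end QuotientSeminorm

/-! ### Softness of tensor products from softness of a factor -/

/-- A positive element `a` has a cut-off `e` such that `aⁿ (1 - e)` is small. -/
theorem CStarAlgebra.exists_cutoff {A : Type*} [NonUnitalCStarAlgebra A] [PartialOrder A]
    [StarOrderedRing A] {a : A} (ha : 0 ≤ a) : ∃ e : A, ∀ n : ℕ, ∃ k : A, ‖k‖ ≤ (1 / 4) ^ (n + 1) ∧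
      ∀ x, (a * ·)^[n + 1] (x - e * x) = k * x ∧ (· * a)^[n + 1] (x - x * e) = x * k := by
  -- `f` vanishes at `0`, as the nonunital functional calculus requires, and equals `1` from `1/4`
  -- on, so only spectrum below `1/4` contributes to `k n = aⁿ⁺¹(1 - f(a))`.
  set f : ℝ → ℝ := fun t => min (4 * t) 1 with hf
  have hfc : Continuous f := by fun_prop
  have hf0 : f 0 = 0 := by simp [hf]
  set k : ℕ → A := fun n => cfcₙ (fun t : ℝ => t ^ (n + 1) * (1 - f t)) a with hk
  have hsa : IsSelfAdjoint a := .of_nonneg ha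
  have hid : cfcₙ (fun t : ℝ => t) a = a := cfcₙ_id' ℝ a
  have hc : ∀ n : ℕ, ContinuousOn (fun t : ℝ => t ^ (n + 1) * (1 - f t)) (quasispectrum ℝ a) :=
    fun n => by fun_prop
  have hfc' : ContinuousOn f (quasispectrum ℝ a) := hfc.continuousOn
  have hbase : a - a * cfcₙ f a = k 0 ∧ a - cfcₙ f a * a = k 0 := by
    constructor
    · conv_lhs => enter [2, 1]; rw [← hid]
      conv_lhs => enter [1]; rw [← hid]
      rw [← cfcₙ_mul .., ← cfcₙ_sub ..]
      exact cfcₙ_congr fun t _ => by ring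
    · conv_lhs => enter [2, 2]; rw [← hid]
      conv_lhs => enter [1]; rw [← hid]
      rw [← cfcₙ_mul .., ← cfcₙ_sub ..]
      exact cfcₙ_congr fun t _ => by ring
  have hstep : ∀ n, a * k n = k (n + 1) ∧ k n * a = k (n + 1) := by
    intro n
    constructor
    · conv_lhs => enter [1]; rw [← hid]
      rw [hk, ← cfcₙ_mul ..]
      exact cfcₙ_congr fun t _ => by ring
    · conv_lhs => enter [2]; rw [← hid]
      rw [hk, ← cfcₙ_mul ..]
      exact cfcₙ_congr fun t _ => by ring
  refine ⟨cfcₙ f a, fun n => ⟨k n, norm_cfcₙ_le fun t ht => ?_, fun x => ?_⟩⟩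
  · have ht0 : 0 ≤ t := quasispectrum_nonneg_of_nonneg a ha t ht
    rcases le_total (4 * t) 1 with h | h
    · have hft : f t = 4 * t := min_eq_left h
      rw [hft, Real.norm_of_nonneg (mul_nonneg (by positivity) (by linarith))]
      calc t ^ (n + 1) * (1 - 4 * t) ≤ (1 / 4) ^ (n + 1) * 1 :=
            mul_le_mul (pow_le_pow_left₀ ht0 (by linarith) _) (by linarith) (by linarith)
              (by positivity)
        _ = _ := mul_one _
    · have hft : f t = 1 := min_eq_right h
      rw [hft]
      simp
  · induction n with
    | zero =>
      simp only [zero_add, Function.iterate_one]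
      rw [mul_sub, ← mul_assoc, ← sub_mul, hbase.1, sub_mul, mul_assoc, ← mul_sub, hbase.2]
      exact ⟨rfl, rfl⟩
    | succ n ih =>
      rw [Function.iterate_succ_apply', Function.iterate_succ_apply' (· * a), ih.1, ih.2,
        ← mul_assoc, (hstep n).1, mul_assoc, (hstep n).2]
      exact ⟨rfl, rfl⟩

/-- If `N a b ≤ ‖a‖ ‖b‖` and `N` decreases at most by the factor `2` under `α × β`, where `β` is
contractive, then `N` vanishes at the points whose `α`-orbit decays like `4⁻ⁿ`. -/
theorem eq_zero_of_le_two_mul_iterate {A B : Type*} [NormedAddCommGroup A] [NormedAddCommGroup B]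
    {N : A → B → ℝ} {α : A → A} {β : B → B} (h0 : ∀ a b, 0 ≤ N a b)
    (hN : ∀ a b, N a b ≤ ‖a‖ * ‖b‖) (h2 : ∀ a b, N a b ≤ 2 * N (α a) (β b))
    (hβ : ∀ b, ‖β b‖ ≤ ‖b‖) {a : A} {C : ℝ} (hα : ∀ n, ‖α^[n + 1] a‖ ≤ (1 / 4) ^ (n + 1) * C)
    (b : B) : N a b = 0 := by
  have hit : ∀ n a b, N a b ≤ 2 ^ n * N (α^[n] a) (β^[n] b) := by
    intro n
    induction n with
    | zero => intro a b; simp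
    | succ n ih =>
      intro a b
      have h := ih (α a) (β b)
      rw [Function.iterate_succ_apply, Function.iterate_succ_apply, pow_succ']
      linarith [h2 a b]
  have hβn : ∀ n, ‖β^[n] b‖ ≤ ‖b‖ := by
    intro n
    induction n with
    | zero => simp
    | succ n ih => rw [Function.iterate_succ_apply']; exact (hβ _).trans ih
  -- The loss `2ⁿ⁺¹` against the decay `4⁻⁽ⁿ⁺¹⁾` leaves `2⁻⁽ⁿ⁺¹⁾`.
  have hb : ∀ n, N a b ≤ (1 / 2) ^ (n + 1) * (C * ‖b‖) := by
    intro n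
    calc N a b ≤ 2 ^ (n + 1) * N (α^[n + 1] a) (β^[n + 1] b) := hit _ _ _
      _ ≤ 2 ^ (n + 1) * ((1 / 4) ^ (n + 1) * C * ‖b‖) := by
        gcongr
        refine (hN _ _).trans ?_
        exact mul_le_mul (hα n) (hβn _) (norm_nonneg _) ((norm_nonneg _).trans (hα n))
      _ = _ := by
        rw [mul_assoc, ← mul_assoc, ← mul_pow]; norm_num
  have h : Filter.Tendsto (fun n : ℕ => ((1 : ℝ) / 2) ^ (n + 1)) Filter.atTop (nhds 0) :=
    (tendsto_pow_atTop_nhds_zero_of_lt_one (by norm_num) (by norm_num)).comp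
      (Filter.tendsto_add_atTop_nat 1)
  have h' := h.mul_const (C * ‖b‖)
  rw [zero_mul] at h'
  exact le_antisymm (ge_of_tendsto h' (Filter.Eventually.of_forall hb)) (h0 a b)

section Multiplicative

variable {A B D : Type*} [NonUnitalCStarAlgebra A] [NonUnitalCStarAlgebra B]
  [NonUnitalCStarAlgebra D] (T : A →ₗ[ℂ] B →ₗ[ℂ] D)

/-- An approximate unit for the algebra generated by the range of a multiplicative bilinear map. -/
theorem exists_approx_unit_of_multiplicative
    (hmul : ∀ a b a' b', T a b * T a' b' = T (a * a') (b * b'))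
    (hnorm : ∀ a b, ‖T a b‖ ≤ ‖a‖ * ‖b‖)
    (hdense : Dense (Submodule.span ℂ (Set.range fun x : A × B => T x.1 x.2) : Set D))
    [PartialOrder A] [StarOrderedRing A] [PartialOrder B] [StarOrderedRing B]
    (u : D) {ε : ℝ} (hε : 0 < ε) :
    ∃ a b, 0 ≤ a ∧ 0 ≤ b ∧ ‖a‖ ≤ 1 ∧ ‖b‖ ≤ 1 ∧ ‖T a b * u - u‖ < ε ∧ ‖u * T a b - u‖ < ε := by
  set l := CStarAlgebra.approximateUnit A ×ˢ CStarAlgebra.approximateUnit B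
  have hA := CStarAlgebra.increasingApproximateUnit A
  have hB := CStarAlgebra.increasingApproximateUnit B
  have := hA.neBot
  have := hB.neBot
  have hT : Continuous fun x : A × B => T x.1 x.2 := by
    let T' := LinearMap.mkContinuous₂ T 1 (fun a b => by simpa using hnorm a b)
    exact (T'.continuous.comp continuous_fst).clm_apply continuous_snd
  have hspan : ∀ s ∈ Submodule.span ℂ (Set.range fun x : A × B => T x.1 x.2),
      Filter.Tendsto (fun x : A × B => T x.1 x.2 * s) l (nhds s) ∧
      Filter.Tendsto (fun x : A × B => s * T x.1 x.2) l (nhds s) := by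
    intro s hs
    induction hs using Submodule.span_induction with
    | mem s hs =>
      obtain ⟨⟨a, b⟩, rfl⟩ := hs
      simp only [hmul]
      constructor
      · exact (hT.tendsto (a, b)).comp
          (((hA.tendsto_mul_right a).comp Filter.tendsto_fst).prodMk_nhds
            ((hB.tendsto_mul_right b).comp Filter.tendsto_snd))
      · exact (hT.tendsto (a, b)).comp
          (((hA.tendsto_mul_left a).comp Filter.tendsto_fst).prodMk_nhds
            ((hB.tendsto_mul_left b).comp Filter.tendsto_snd))
    | zero => simp
    | add x y _ _ hx hy =>
      simp only [mul_add, add_mul]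
      exact ⟨hx.1.add hy.1, hx.2.add hy.2⟩
    | smul c x _ hx =>
      simp only [mul_smul_comm, smul_mul_assoc]
      exact ⟨hx.1.const_smul c, hx.2.const_smul c⟩
  -- Three errors occur below: `u - s` twice, once multiplied by the contraction `T a b`, and the
  -- error on `s`; each is below `ε / 4`.
  obtain ⟨s, hs, hus⟩ := Metric.mem_closure_iff.1 (hdense u) (ε / 4) (by positivity)
  rw [dist_eq_norm] at hus
  have hs' := hspan s hs
  have e1 := (tendsto_iff_norm_sub_tendsto_zero.1 hs'.1).eventually
    (gt_mem_nhds (show (0 : ℝ) < ε / 4 by positivity))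
  have e2 := (tendsto_iff_norm_sub_tendsto_zero.1 hs'.2).eventually
    (gt_mem_nhds (show (0 : ℝ) < ε / 4 by positivity))
  obtain ⟨⟨a, b⟩, h1, h2, ⟨ha, ha1⟩, hb, hb1⟩ := (e1.and (e2.and
    (((hA.eventually_nonneg.and hA.eventually_norm)).prod_mk
      (hB.eventually_nonneg.and hB.eventually_norm)))).exists
  have hT1 : ‖T a b‖ ≤ 1 := (hnorm a b).trans (mul_le_one₀ ha1 (norm_nonneg _) hb1)
  refine ⟨a, b, ha, hb, ha1, hb1, ?_, ?_⟩
  · have : T a b * u - u = T a b * (u - s) + (T a b * s - s) - (u - s) := by noncomm_ring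
    rw [this]
    have h3 : ‖T a b * (u - s)‖ ≤ ‖u - s‖ := (norm_mul_le _ _).trans
      (mul_le_of_le_one_left (norm_nonneg _) hT1)
    have := norm_sub_le (T a b * (u - s) + (T a b * s - s)) (u - s)
    have := norm_add_le (T a b * (u - s)) (T a b * s - s)
    dsimp only at h1
    linarith
  · have : u * T a b - u = (u - s) * T a b + (s * T a b - s) - (u - s) := by noncomm_ring
    rw [this]
    have h3 : ‖(u - s) * T a b‖ ≤ ‖u - s‖ := (norm_mul_le _ _).trans
      (mul_le_of_le_one_right (norm_nonneg _) hT1)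
    have := norm_sub_le ((u - s) * T a b + (s * T a b - s)) (u - s)
    have := norm_add_le ((u - s) * T a b) (s * T a b - s)
    dsimp only at h2
    linarith

/-- A C*-algebra densely spanned by the range of a multiplicative contractive bilinear map is soft
if the first factor is. -/
theorem isSoft_of_multiplicative (hA : IsSoft A)
    (hmul : ∀ a b a' b', T a b * T a' b' = T (a * a') (b * b'))
    (hnorm : ∀ a b, ‖T a b‖ ≤ ‖a‖ * ‖b‖)
    (hdense : Dense (Submodule.span ℂ (Set.range fun x : A × B => T x.1 x.2) : Set D)) :
    IsSoft D := by
  let _ := CStarAlgebra.spectralOrder A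
  let _ := CStarAlgebra.spectralOrderedRing A
  let _ := CStarAlgebra.spectralOrder B
  let _ := CStarAlgebra.spectralOrderedRing B
  contrapose! hA
  obtain ⟨J, hJs, hJc, hJt, u, hu⟩ := not_isSoft_iff.1 hA
  obtain ⟨a₀, b₀, ha₀, hb₀, ha1, hb1, hL, hR⟩ :=
    exists_approx_unit_of_multiplicative T hmul hnorm hdense u (ε := 1 / 2) (by norm_num)
  have hTc : ∀ b, Continuous fun a => T a b := fun b =>
    AddMonoidHomClass.continuous_of_bound (T.flip b) ‖b‖ fun a => by
      simpa [mul_comm] using hnorm a b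
  have hTc' : ∀ a, Continuous fun b => T a b := fun a =>
    AddMonoidHomClass.continuous_of_bound (T a) ‖a‖ fun b => hnorm a b
  have hB := CStarAlgebra.increasingApproximateUnit B
  have := hB.neBot
  -- `B` need not have a unit, so a product `xy` is handled through an approximate unit `v` of `B`:
  -- `T (xy) (vb) = T x v * T y b`, and `J` is closed.
  let I : TwoSidedIdeal A := TwoSidedIdeal.mk' {a | ∀ b, T a b ∈ J}
    (fun b => by rw [map_zero]; exact J.zero_mem)
    (fun hx hy b => by rw [map_add]; exact J.add_mem (hx b) (hy b))
    (fun hx b => by rw [map_neg]; exact J.neg_mem (hx b))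
    (fun {x y} hy b => hJc.mem_of_tendsto
      (((hTc' (x * y)).tendsto b).comp (hB.tendsto_mul_right b))
      (Filter.Eventually.of_forall fun v => by
        change T (x * y) (v * b) ∈ J
        rw [← hmul]
        exact J.mul_mem_left _ _ (hy b)))
    (fun {x y} hx b => hJc.mem_of_tendsto
      (((hTc' (x * y)).tendsto b).comp (hB.tendsto_mul_left b))
      (Filter.Eventually.of_forall fun v => by
        change T (x * y) (b * v) ∈ J
        rw [← hmul]
        exact J.mul_mem_right _ _ (hx b)))
  have hI : ∀ a, a ∈ I ↔ ∀ b, T a b ∈ J := fun a => TwoSidedIdeal.mem_mk' _ _ _ _ _ _ a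
  -- With `t = T a₀ b₀`, one has `tx - x ≡ (tu - u)x` modulo `J`, which has quotient norm at most
  -- half that of `x`.
  have htwoL : ∀ x, J.quotNorm x ≤ 2 * J.quotNorm (T a₀ b₀ * x) := by
    intro x
    have h1 := J.quotNorm_add_le (T a₀ b₀ * x) (-(T a₀ b₀ * x - x))
    have h2 : J.quotNorm (T a₀ b₀ * x - x) = J.quotNorm ((T a₀ b₀ * u - u) * x) := by
      refine (J.quotNorm_eq_of_sub_mem ?_).symm
      have := J.sub_mem (J.mul_mem_left (T a₀ b₀) _ (hu x).1) (hu x).1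
      convert this using 1
      noncomm_ring
    have h3 := J.quotNorm_mul_le (T a₀ b₀ * u - u) x
    have h4 := mul_le_mul_of_nonneg_right ((J.quotNorm_le_norm _).trans hL.le)
      (J.quotNorm_nonneg x)
    rw [J.quotNorm_neg, neg_sub, add_sub_cancel] at h1
    linarith
  have htwoR : ∀ x, J.quotNorm x ≤ 2 * J.quotNorm (x * T a₀ b₀) := by
    intro x
    have h1 := J.quotNorm_add_le (x * T a₀ b₀) (-(x * T a₀ b₀ - x))
    have h2 : J.quotNorm (x * T a₀ b₀ - x) = J.quotNorm (x * (u * T a₀ b₀ - u)) := by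
      refine (J.quotNorm_eq_of_sub_mem ?_).symm
      have := J.sub_mem (J.mul_mem_right _ (T a₀ b₀) (hu x).2) (hu x).2
      convert this using 1
      noncomm_ring
    have h3 := J.quotNorm_mul_le x (u * T a₀ b₀ - u)
    have h4 := mul_le_mul_of_nonneg_left ((J.quotNorm_le_norm _).trans hR.le)
      (J.quotNorm_nonneg x)
    rw [J.quotNorm_neg, neg_sub, add_sub_cancel] at h1
    linarith
  obtain ⟨e, he⟩ := CStarAlgebra.exists_cutoff ha₀
  choose k hk hke using he
  refine not_isSoft_iff.2 ⟨I, fun c x hx => (hI _).2 fun b => ?_, ?_, ?_, e, fun x => ?_⟩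
  · rw [map_smul, LinearMap.smul_apply]
    exact hJs c _ ((hI x).1 hx b)
  · have : (I : Set A) = ⋂ b, (fun a => T a b) ⁻¹' (J : Set D) := by
      ext a
      simp [hI]
    rw [this]
    exact isClosed_iInter fun b => hJc.preimage (hTc b)
  · intro h
    refine hJt (TwoSidedIdeal.ext fun x => ⟨fun _ => TwoSidedIdeal.mem_top D, fun _ => ?_⟩)
    refine closure_minimal (fun s hs => ?_) hJc (hdense x)
    induction hs using Submodule.span_induction with
    | mem s hs =>
      obtain ⟨⟨a, b⟩, rfl⟩ := hs
      exact (hI a).1 (h ▸ TwoSidedIdeal.mem_top A) b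
    | zero => exact J.zero_mem
    | add x y _ _ hx hy => exact J.add_mem hx hy
    | smul c x _ hx => exact hJs c x hx
  · have hq0 : ∀ a b, 0 ≤ J.quotNorm (T a b) := fun a b => J.quotNorm_nonneg _
    have hqn : ∀ a b, J.quotNorm (T a b) ≤ ‖a‖ * ‖b‖ := fun a b =>
      (J.quotNorm_le_norm _).trans (hnorm a b)
    have hl : x - e * x ∈ I := (hI _).2 fun b => by
      rw [← J.quotNorm_eq_zero_iff hJc]
      refine eq_zero_of_le_two_mul_iterate (α := (a₀ * ·)) (β := (b₀ * ·)) hq0 hqn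
        (fun a b => by rw [← hmul]; exact htwoL _)
        (fun b => (norm_mul_le _ _).trans (mul_le_of_le_one_left (norm_nonneg _) hb1))
        (C := ‖x‖) (fun n => ?_) b
      rw [(hke n x).1]
      exact (norm_mul_le _ _).trans (mul_le_mul_of_nonneg_right (hk n) (norm_nonneg _))
    have hr : x - x * e ∈ I := (hI _).2 fun b => by
      rw [← J.quotNorm_eq_zero_iff hJc]
      refine eq_zero_of_le_two_mul_iterate (α := (· * a₀)) (β := (· * b₀)) hq0 hqn
        (fun a b => by rw [← hmul]; exact htwoR _)
        (fun b => (norm_mul_le _ _).trans (mul_le_of_le_one_right (norm_nonneg _) hb1))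
        (C := ‖x‖) (fun n => ?_) b
      rw [(hke n x).2, mul_comm _ ‖x‖]
      exact (norm_mul_le _ _).trans (mul_le_mul_of_nonneg_left (hk n) (norm_nonneg _))
    exact ⟨by simpa using I.neg_mem hl, by simpa using I.neg_mem hr⟩

end Multiplicative

/-! ### Completions of the algebraic tensor product -/

namespace CStarSeminorm

variable {A B : Type*} [NonUnitalCStarAlgebra A] [NonUnitalCStarAlgebra B]

/-- The bilinear map `(a, b) ↦ a ⊗ b` into the completion. -/
noncomputable def completionTmul (p : CStarSeminorm (A ⊗[ℂ] B)) : A →ₗ[ℂ] B →ₗ[ℂ] p.Completion :=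
  (TensorProduct.mk ℂ A B).compr₂
    ((p.toCompletion : (A ⊗[ℂ] B) →ₙₐ[ℂ] p.Completion) : (A ⊗[ℂ] B) →ₗ[ℂ] p.Completion)

variable (p : CStarSeminorm (A ⊗[ℂ] B))

theorem completionTmul_apply (a : A) (b : B) :
    p.completionTmul a b = p.toCompletion (a ⊗ₜ b) := rfl

theorem completionTmul_mul (a : A) (b : B) (a' : A) (b' : B) :
    p.completionTmul a b * p.completionTmul a' b' = p.completionTmul (a * a') (b * b') := by
  rw [completionTmul_apply, completionTmul_apply, completionTmul_apply, ← map_mul,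
    Algebra.TensorProduct.tmul_mul_tmul]

theorem norm_completionTmul_le (a : A) (b : B) : ‖p.completionTmul a b‖ ≤ ‖a‖ * ‖b‖ :=
  (p.norm_toCompletion _).trans_le (CStarTensor.seminorm_tmul_le p a b)

theorem dense_span_completionTmul :
    Dense (Submodule.span ℂ (Set.range fun x : A × B => p.completionTmul x.1 x.2) :
      Set p.Completion) := by
  refine p.denseRange_toCompletion.mono ?_
  rintro _ ⟨s, rfl⟩
  induction s using TensorProduct.induction_on with
  | zero => rw [map_zero]; exact zero_mem _
  | tmul a b => exact Submodule.subset_span ⟨(a, b), rfl⟩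
  | add x y hx hy => rw [map_add]; exact add_mem hx hy

/-- A C*-algebraic tensor product is soft if one of the factors is soft. -/
theorem isSoft_completion (h : IsSoft A ∨ IsSoft B) : IsSoft p.Completion := by
  rcases h with h | h
  · exact isSoft_of_multiplicative p.completionTmul h p.completionTmul_mul
      p.norm_completionTmul_le p.dense_span_completionTmul
  -- An abstract bilinear map makes the argument symmetric: flipping it exchanges the factors.
  · refine isSoft_of_multiplicative p.completionTmul.flip h
      (fun b a b' a' => p.completionTmul_mul a b a' b')
      (fun b a => (p.norm_completionTmul_le a b).trans_eq (mul_comm _ _))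
      (p.dense_span_completionTmul.mono (Submodule.span_mono ?_))
    rintro _ ⟨⟨a, b⟩, rfl⟩
    exact ⟨(b, a), rfl⟩

end CStarSeminorm

/-! ### Unital quotients of tensor products from unital quotients of the factors -/

/-- Closed two-sided ideals have approximate left units. -/
theorem TwoSidedIdeal.exists_approx_left_unit {A : Type*} [NonUnitalCStarAlgebra A]
    (I : TwoSidedIdeal A) (F : Finset A) (hF : ∀ i ∈ F, i ∈ I) {ε : ℝ} (hε : 0 < ε) :
    ∃ u ∈ I, ‖u‖ ≤ 1 ∧ ∀ i ∈ F, ‖i - u * i‖ ≤ ε := by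
  let _ := CStarAlgebra.spectralOrder A
  let _ := CStarAlgebra.spectralOrderedRing A
  -- The functional calculus below bounds `‖i - ui‖²` by `η`. All of `F` is treated at once, because
  -- each `(i - ui)(i - ui)*` lies below the sum `(1 - u)h(1 - u)`.
  set η : ℝ := ε ^ 2 with hη
  have hη0 : 0 < η := by positivity
  set h : A := ∑ i ∈ F, i * star i with hh
  have hpos : 0 ≤ h := Finset.sum_nonneg fun i _ => mul_star_self_nonneg i
  have hI : h ∈ I := sum_mem fun i hi => I.mul_mem_right _ _ (hF i hi)
  have hsa : IsSelfAdjoint h := .of_nonneg hpos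
  have hid : cfcₙ (fun t : ℝ => t) h = h := cfcₙ_id' ℝ h
  have hne : ∀ t : ℝ, t ^ 2 + η ^ 2 ≠ 0 := fun t => by positivity
  -- Writing `u = h²(h² + η²)⁻¹` as `h · k(h)` puts `u` in `I` without appeal to closedness.
  set k : ℝ → ℝ := fun t => t / (t ^ 2 + η ^ 2) with hk
  have hkc : Continuous k := continuous_id.div (by fun_prop) hne
  have hkc' : ContinuousOn k (quasispectrum ℝ h) := hkc.continuousOn
  have hk0 : k 0 = 0 := by simp [hk]
  set u : A := cfcₙ (fun t => t * k t) h with hu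
  have hustar : star u = u := (cfcₙ_predicate _ _ : IsSelfAdjoint u).star_eq
  have huI : u ∈ I := by
    have : u = h * cfcₙ k h := by
      conv_rhs => enter [1]; rw [← hid]
      rw [hu, ← cfcₙ_mul ..]
    rw [this]
    exact I.mul_mem_right _ _ hI
  refine ⟨u, huI, norm_cfcₙ_le fun t _ => ?_, fun i hi => ?_⟩
  · have : t * k t = t ^ 2 / (t ^ 2 + η ^ 2) := by rw [hk]; ring
    rw [this, Real.norm_of_nonneg (by positivity), div_le_one (by positivity)]
    nlinarith
  have hsum : ∑ i ∈ F, (i - u * i) * star (i - u * i) = h - u * h - h * u + u * h * u := by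
    rw [hh, Finset.mul_sum, Finset.sum_mul, Finset.sum_mul, ← Finset.sum_sub_distrib,
      ← Finset.sum_sub_distrib, ← Finset.sum_add_distrib]
    refine Finset.sum_congr rfl fun i _ => ?_
    rw [star_sub, star_mul, hustar]
    noncomm_ring
  have hcfc : ∀ g : ℝ → ℝ, Continuous g → g 0 = 0 → h - cfcₙ g h * h - h * cfcₙ g h +
      cfcₙ g h * h * cfcₙ g h = cfcₙ (fun t => t * (1 - g t) ^ 2) h := by
    intro g hg hg0
    have hg' : ContinuousOn g (quasispectrum ℝ h) := hg.continuousOn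
    have h1 : cfcₙ g h * h = cfcₙ (fun t => g t * t) h := by
      rw [cfcₙ_mul (hg0 := rfl) .., hid]
    have h2 : h * cfcₙ g h = cfcₙ (fun t => t * g t) h := by
      rw [cfcₙ_mul (hf0 := rfl) .., hid]
    have h3 : cfcₙ g h * h * cfcₙ g h = cfcₙ (fun t => g t * t * g t) h := by
      rw [h1, ← cfcₙ_mul (hf0 := by simp) ..]
    rw [h3, h1, h2]
    conv_lhs => enter [1, 1, 1]; rw [← hid]
    rw [← cfcₙ_sub (hf0 := rfl) (hg0 := by simp) ..,
      ← cfcₙ_sub (hf0 := by simp) (hg0 := by simp) ..,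
      ← cfcₙ_add (hf0 := by simp) (hg0 := by simp) ..]
    exact cfcₙ_congr fun t _ => by ring
  have hle : (i - u * i) * star (i - u * i) ≤ ∑ i ∈ F, (i - u * i) * star (i - u * i) :=
    Finset.single_le_sum (f := fun i => (i - u * i) * star (i - u * i))
      (fun j _ => mul_star_self_nonneg _) hi
  have hn := CStarAlgebra.norm_le_norm_of_nonneg_of_le (mul_star_self_nonneg _) hle
  rw [hsum, hu, hcfc _ (by fun_prop) (by simp), CStarRing.norm_self_mul_star] at hn
  have hb : ‖cfcₙ (fun t => t * (1 - t * k t) ^ 2) h‖ ≤ η := norm_cfcₙ_le fun t ht => by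
    have ht0 : 0 ≤ t := quasispectrum_nonneg_of_nonneg h hpos t ht
    have h1 : t * (1 - t * k t) ^ 2 = t * η ^ 4 / (t ^ 2 + η ^ 2) ^ 2 := by
      rw [hk]
      field_simp
      ring
    rw [h1, Real.norm_of_nonneg (by positivity), div_le_iff₀ (by positivity)]
    have h2 : t * η ≤ t ^ 2 + η ^ 2 := by nlinarith [sq_nonneg (t - η)]
    have h3 : η ^ 2 ≤ t ^ 2 + η ^ 2 := by nlinarith
    calc t * η ^ 4 = η * ((t * η) * η ^ 2) := by ring
      _ ≤ η * ((t ^ 2 + η ^ 2) * (t ^ 2 + η ^ 2)) := by gcongr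
      _ = _ := by ring
  rw [← sq] at hn
  exact le_of_sq_le_sq (hn.trans hb) hε.le

/-- If `e` is a unit modulo the closed ideal `I`, then `e` can be multiplied by bounded elements
that asymptotically annihilate `I` without making it small. -/
theorem TwoSidedIdeal.exists_asymptotic_annihilator {A : Type*} [NonUnitalCStarAlgebra A]
    (I : TwoSidedIdeal A) (hI : IsClosed (I : Set A)) (hI' : I ≠ ⊤) {e : A}
    (he : ∀ x : A, e * x - x ∈ I ∧ x * e - x ∈ I) :
    ∃ v : Finset I × ℕ → A, (∀ t, ‖v t‖ ≤ 2 * ‖e‖) ∧ (∀ t, 1 ≤ ‖v t * e‖) ∧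
      ∀ i ∈ I, Filter.Tendsto (fun t => v t * i) Filter.atTop (nhds 0) := by
  have h := fun t : Finset I × ℕ => I.exists_approx_left_unit (t.1.map ⟨_, Subtype.val_injective⟩)
    (by simp +contextual) (ε := 1 / ((t.2 : ℝ) + 1)) (by positivity)
  choose u huI hu1 hu using h
  -- This is `e(1 - u)`, with `e` standing in for the missing unit. Modulo `I`, `e(1 - u)e ≡ e² ≡
  -- e`, whose quotient norm is at least `1`; on `i ∈ I` it gives `e(i - ui)`.
  refine ⟨fun t => e - e * u t, fun t => ?_, fun t => ?_, fun i hi => ?_⟩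
  · have := norm_sub_le e (e * u t)
    have := (norm_mul_le e (u t)).trans (mul_le_of_le_one_right (norm_nonneg _) (hu1 t))
    linarith
  · refine (I.one_le_quotNorm_of_modularUnit hI hI' he).trans ?_
    rw [← I.quotNorm_eq_of_sub_mem (x := (e - e * u t) * e)]
    · exact I.quotNorm_le_norm _
    · have := I.sub_mem (he e).1 (I.mul_mem_right _ e (I.mul_mem_left e _ (huI t)))
      convert this using 1
      noncomm_ring
  · have hlim : Filter.Tendsto (fun t : Finset I × ℕ => ‖e‖ * (1 / ((t.2 : ℝ) + 1)))
        Filter.atTop (nhds 0) := by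
      rw [← Filter.prod_atTop_atTop_eq]
      simpa using (tendsto_one_div_add_atTop_nhds_zero_nat.comp Filter.tendsto_snd).const_mul ‖e‖
    refine squeeze_zero_norm' ?_ hlim
    filter_upwards [Filter.eventually_ge_atTop ({⟨i, hi⟩}, 0)] with t ht
    have := hu t i (Finset.mem_map.2 ⟨⟨i, hi⟩, ht.1 (Finset.mem_singleton_self _), rfl⟩)
    have h2 : (e - e * u t) * i = e * (i - u t * i) := by noncomm_ring
    rw [h2]
    exact (norm_mul_le _ _).trans (mul_le_mul_of_nonneg_left this (norm_nonneg _))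

/-- A C*-algebra densely spanned by the range of a multiplicative bilinear map with
`‖T a b‖ = ‖a‖ ‖b‖` is not soft if neither factor is. -/
theorem not_isSoft_of_multiplicative {A B D : Type*} [NonUnitalCStarAlgebra A]
    [NonUnitalCStarAlgebra B] [NonUnitalCStarAlgebra D] (T : A →ₗ[ℂ] B →ₗ[ℂ] D)
    (hA : ¬ IsSoft A) (hB : ¬ IsSoft B)
    (hmul : ∀ a b a' b', T a b * T a' b' = T (a * a') (b * b'))
    (hnorm : ∀ a b, ‖T a b‖ = ‖a‖ * ‖b‖)
    (hdense : Dense (Submodule.span ℂ (Set.range fun x : A × B => T x.1 x.2) : Set D)) :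
    ¬ IsSoft D := by
  classical
  obtain ⟨I, hIs, hIc, hIt, e, he⟩ := not_isSoft_iff.1 hA
  obtain ⟨J, hJs, hJc, hJt, f, hf⟩ := not_isSoft_iff.1 hB
  obtain ⟨v, hv, hve, hvI⟩ := I.exists_asymptotic_annihilator hIc hIt he
  obtain ⟨w, hw, hwf, hwJ⟩ := J.exists_asymptotic_annihilator hJc hJt hf
  set R := Submodule.span ℂ (Set.range fun x : A × B => T x.1 x.2) with hR
  set G : Set D := {d | ∃ a b, (a ∈ I ∨ b ∈ J) ∧ T a b = d} with hG
  set S := Submodule.span ℂ G with hS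
  have hRS : ∀ x ∈ R, ∀ y ∈ S, x * y ∈ S ∧ y * x ∈ S := by
    intro x hx y hy
    induction hx using Submodule.span_induction with
    | mem x hx =>
      obtain ⟨⟨a, b⟩, rfl⟩ := hx
      induction hy using Submodule.span_induction with
      | mem y hy =>
        obtain ⟨c, d, hcd, rfl⟩ := hy
        dsimp only
        rw [hmul, hmul]
        exact ⟨Submodule.subset_span ⟨_, _,
            hcd.imp (I.mul_mem_left _ _) (J.mul_mem_left _ _), rfl⟩,
          Submodule.subset_span ⟨_, _,
            hcd.imp (I.mul_mem_right _ _) (J.mul_mem_right _ _), rfl⟩⟩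
      | zero => simp
      | add y z _ _ hy hz =>
        rw [mul_add, add_mul]
        exact ⟨add_mem hy.1 hz.1, add_mem hy.2 hz.2⟩
      | smul c y _ hy =>
        rw [mul_smul_comm, smul_mul_assoc]
        exact ⟨S.smul_mem c hy.1, S.smul_mem c hy.2⟩
    | zero => simp
    | add x z _ _ hx hz =>
      rw [mul_add, add_mul]
      exact ⟨add_mem hx.1 hz.1, add_mem hx.2 hz.2⟩
    | smul c x _ hx =>
      rw [mul_smul_comm, smul_mul_assoc]
      exact ⟨S.smul_mem c hx.1, S.smul_mem c hx.2⟩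
  -- `S` is only known to absorb products with the dense subspace `R`; joint continuity extends this
  -- to `D` after closing `S`.
  let K : TwoSidedIdeal D := TwoSidedIdeal.mk' (S.topologicalClosure : Set D)
    (zero_mem S.topologicalClosure) (fun hx hy => add_mem hx hy) (fun hx => neg_mem hx)
    (fun {x y} hy => map_mem_closure₂ continuous_mul (hdense x) hy
      fun x hx y hy => (hRS x hx y hy).1)
    (fun {x y} hx => map_mem_closure₂ continuous_mul hx (hdense y)
      fun x hx y hy => (hRS y hy x hx).2)
  have hK : ∀ x, x ∈ K ↔ x ∈ S.topologicalClosure :=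
    fun x => TwoSidedIdeal.mem_mk' _ _ _ _ _ _ x
  -- On a generator one tensor factor tends to zero while the other stays bounded.
  have hlim : ∀ x ∈ S, Filter.Tendsto (fun t : (Finset I × ℕ) × (Finset J × ℕ) =>
      T (v t.1) (w t.2) * x) (Filter.atTop ×ˢ Filter.atTop) (nhds 0) := by
    intro x hx
    induction hx using Submodule.span_induction with
    | mem x hx =>
      obtain ⟨a, b, hab, rfl⟩ := hx
      simp only [hmul]
      rcases hab with ha | hb
      · have h := ((hvI a ha).comp (Filter.tendsto_fst (g := Filter.atTop (α := Finset J × ℕ)))).norm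
        have h' := h.mul_const (2 * ‖f‖ * ‖b‖)
        rw [norm_zero, zero_mul] at h'
        refine squeeze_zero_norm (fun t => ?_) h'
        rw [hnorm]
        exact mul_le_mul_of_nonneg_left ((norm_mul_le _ _).trans
          (mul_le_mul_of_nonneg_right (hw _) (norm_nonneg _))) (norm_nonneg _)
      · have h := ((hwJ b hb).comp (Filter.tendsto_snd (f := Filter.atTop (α := Finset I × ℕ)))).norm
        have h' := h.const_mul (2 * ‖e‖ * ‖a‖)
        rw [norm_zero, mul_zero] at h'
        refine squeeze_zero_norm (fun t => ?_) h'
        rw [hnorm]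
        exact mul_le_mul_of_nonneg_right ((norm_mul_le _ _).trans
          (mul_le_mul_of_nonneg_right (hv _) (norm_nonneg _))) (norm_nonneg _)
    | zero => simpa only [mul_zero] using tendsto_const_nhds
    | add x y _ _ hx hy => simpa [mul_add] using hx.add hy
    | smul c x _ hx => simpa [mul_smul_comm] using hx.const_smul c
  refine not_isSoft_iff.2 ⟨K, fun c x hx => ?_, ?_, fun hKt => ?_, T e f, fun x => ?_⟩
  · rw [hK] at hx ⊢
    exact Submodule.smul_mem _ c hx
  · have : (K : Set D) = S.topologicalClosure := Set.ext hK
    rw [this]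
    exact S.isClosed_topologicalClosure
  · have hmem : T e f ∈ closure (S : Set D) := (hK _).1 (hKt ▸ TwoSidedIdeal.mem_top D)
    -- `C` is chosen so that replacing `T e f` by a `1 / C`-close `x ∈ S` costs at most `1/4` after
    -- multiplication by `T v w`; the rest falls below `1/2`, against the lower bound `1`.
    set C : ℝ := 4 * (2 * ‖e‖ * (2 * ‖f‖) + 1) with hC
    have hC0 : 0 < C := by positivity
    obtain ⟨x, hx, hxd⟩ := Metric.mem_closure_iff.1 hmem (1 / C) (by positivity)
    rw [dist_eq_norm] at hxd
    have hev := (hlim x hx).norm.eventually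
      (gt_mem_nhds (show ‖(0 : D)‖ < 1 / 2 by simp))
    obtain ⟨t, ht⟩ := hev.exists
    have h1 : (1 : ℝ) ≤ ‖T (v t.1) (w t.2) * T e f‖ := by
      rw [hmul, hnorm]
      exact one_le_mul_of_one_le_of_one_le (hve _) (hwf _)
    have h2 : ‖T (v t.1) (w t.2) * (T e f - x)‖ ≤ (2 * ‖e‖ * (2 * ‖f‖)) * (1 / C) := by
      refine (norm_mul_le _ _).trans (mul_le_mul ?_ hxd.le (norm_nonneg _) (by positivity))
      rw [hnorm]
      exact mul_le_mul (hv _) (hw _) (norm_nonneg _) (by positivity)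
    have h3 : (2 * ‖e‖ * (2 * ‖f‖)) * (1 / C) ≤ 1 / 4 := by
      rw [mul_one_div, div_le_iff₀ hC0]
      linarith
    have h4 := norm_add_le (T (v t.1) (w t.2) * (T e f - x)) (T (v t.1) (w t.2) * x)
    rw [← mul_add, sub_add_cancel] at h4
    linarith
  · rw [hK, hK]
    have hcl : IsClosed {x : D | T e f * x - x ∈ S.topologicalClosure ∧
        x * T e f - x ∈ S.topologicalClosure} :=
      (S.isClosed_topologicalClosure.preimage (by fun_prop)).inter
        (S.isClosed_topologicalClosure.preimage (by fun_prop))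
    refine closure_minimal (fun s hs => ?_) hcl (hdense x)
    have hgen : ∀ a b, (a ∈ I ∨ b ∈ J) → T a b ∈ S.topologicalClosure := fun a b h =>
      subset_closure (Submodule.subset_span ⟨a, b, h, rfl⟩)
    change _ ∈ S.topologicalClosure ∧ _ ∈ S.topologicalClosure
    induction hs using Submodule.span_induction with
    | mem x hx =>
      obtain ⟨⟨a, b⟩, rfl⟩ := hx
      dsimp only
      rw [hmul, hmul]
      have h1 : T (e * a) (f * b) - T a b = T (e * a - a) (f * b) + T a (f * b - b) := by
        simp
      have h2 : T (a * e) (b * f) - T a b = T (a * e - a) (b * f) + T a (b * f - b) := by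
        simp
      rw [h1, h2]
      exact ⟨add_mem (hgen _ _ (.inl (he a).1)) (hgen _ _ (.inr (hf b).1)),
        add_mem (hgen _ _ (.inl (he a).2)) (hgen _ _ (.inr (hf b).2))⟩
    | zero => simp
    | add x y _ _ hx hy =>
      rw [mul_add, add_mul, add_sub_add_comm, add_sub_add_comm]
      exact ⟨add_mem hx.1 hy.1, add_mem hx.2 hy.2⟩
    | smul c x _ hx =>
      rw [mul_smul_comm, smul_mul_assoc, ← smul_sub, ← smul_sub]
      exact ⟨Submodule.smul_mem _ c hx.1, Submodule.smul_mem _ c hx.2⟩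

/-- A C*-algebraic tensor product with a cross seminorm is soft only if one of the factors is. -/
theorem CStarSeminorm.isSoft_or_isSoft {A B : Type*} [NonUnitalCStarAlgebra A]
    [NonUnitalCStarAlgebra B] (p : CStarSeminorm (A ⊗[ℂ] B))
    (hp : ∀ (a : A) (b : B), p (a ⊗ₜ b) = ‖a‖ * ‖b‖) (h : IsSoft p.Completion) :
    IsSoft A ∨ IsSoft B := by
  contrapose! h
  exact not_isSoft_of_multiplicative p.completionTmul h.1 h.2 p.completionTmul_mul
    (fun a b => (p.norm_toCompletion _).trans (hp a b)) p.dense_span_completionTmul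

/-! ### Norming states and representations -/

section State

open scoped ComplexOrder

/-- Every nonzero positive element is normed by a state. -/
theorem CStarAlgebra.exists_state_apply_eq_norm {E : Type*} [CStarAlgebra E] [PartialOrder E]
    [StarOrderedRing E] {h : E} (hpos : 0 ≤ h) (hne : h ≠ 0) :
    ∃ G : E →ₚ[ℂ] ℂ, G 1 = 1 ∧ G h = ‖h‖ := by
  have hn : 0 < ‖h‖ := norm_pos_iff.2 hne
  have : Nontrivial E := ⟨h, 0, hne⟩
  -- A contractive functional that norms `‖h‖ · 1 + h`, of norm at least `2‖h‖`, must norm both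
  -- summands, so it is unital and norms `h`, up to real parts.
  set x₀ : E := algebraMap ℝ E ‖h‖ + h with hx₀
  have halg : (0 : E) ≤ algebraMap ℝ E ‖h‖ := algebraMap_nonneg _ (norm_nonneg h)
  have hx₀pos : 0 ≤ x₀ := add_nonneg halg hpos
  have hx₀n : 2 * ‖h‖ ≤ ‖x₀‖ := by
    have h1 : ‖h‖ ≤ ‖x₀‖ := CStarAlgebra.norm_le_norm_of_nonneg_of_le hpos
      (le_add_of_nonneg_left halg)
    have h2 : x₀ ≤ algebraMap ℝ E ‖x₀‖ :=
      (CStarAlgebra.norm_le_iff_le_algebraMap x₀ (norm_nonneg _) hx₀pos).1 le_rfl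
    have h3 : h ≤ algebraMap ℝ E (‖x₀‖ - ‖h‖) := by
      rw [map_sub, le_sub_iff_add_le, add_comm]
      exact h2
    have := (CStarAlgebra.norm_le_iff_le_algebraMap h (sub_nonneg.2 h1) hpos).2 h3
    linarith
  obtain ⟨φ, hφ1, hφ⟩ := exists_dual_vector'' ℂ x₀
  have hre : ∀ x, (φ x).re ≤ ‖x‖ := fun x => (Complex.re_le_norm _).trans
    ((φ.le_opNorm x).trans (mul_le_of_le_one_left (norm_nonneg _) hφ1))
  have halgφ : ∀ r : ℝ, φ (algebraMap ℝ E r) = r * φ 1 := fun r => by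
    rw [Algebra.algebraMap_eq_smul_one, ← Complex.coe_smul, map_smul, smul_eq_mul]
  have hsum : ‖x₀‖ = ‖h‖ * (φ 1).re + (φ h).re := by
    have := congrArg Complex.re hφ
    rw [hx₀, map_add, halgφ, Complex.add_re, Complex.re_ofReal_mul] at this
    exact this.symm
  have h1le : (φ 1).re ≤ 1 := by simpa using hre 1
  have hφone : (φ 1).re = 1 := by
    refine le_antisymm h1le ?_
    have := hre h
    by_contra! hlt
    nlinarith
  have hφh : (φ h).re = ‖h‖ := by
    have := hre h
    rw [hφone] at hsum
    linarith
  -- The element `‖x‖ · 1 - x` has norm at most `‖x‖`, so `‖x‖ - Re φ(x) ≤ ‖x‖`.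
  have hφpos : ∀ x, 0 ≤ x → 0 ≤ (φ x).re := by
    intro x hx
    have h1 : x ≤ algebraMap ℝ E ‖x‖ :=
      (CStarAlgebra.norm_le_iff_le_algebraMap x (norm_nonneg _) hx).1 le_rfl
    have h2 : ‖algebraMap ℝ E ‖x‖ - x‖ ≤ ‖x‖ :=
      (CStarAlgebra.norm_le_iff_le_algebraMap _ (norm_nonneg _) (sub_nonneg.2 h1)).2
        (sub_le_self _ hx)
    have h3 := (hre (algebraMap ℝ E ‖x‖ - x)).trans h2
    rw [map_sub, halgφ, Complex.sub_re, Complex.re_ofReal_mul, hφone] at h3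
    linarith
  -- The Hermitian part of `φ` agrees with `Re φ` on self-adjoint elements and so is positive.
  let G₀ : E →ₗ[ℂ] ℂ :=
    { toFun := fun x => (φ x + star (φ (star x))) / 2
      map_add' := fun x y => by simp only [star_add, map_add]; ring
      map_smul' := fun c x => by
        simp only [star_smul, map_smul, smul_eq_mul, star_mul', star_star, RingHom.id_apply]
        ring }
  have hG : ∀ x, IsSelfAdjoint x → G₀ x = (φ x).re := fun x hx => by
    change (φ x + star (φ (star x))) / 2 = _
    rw [hx.star_eq]
    change (φ x + (starRingEnd ℂ) (φ x)) / 2 = _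
    rw [Complex.add_conj]
    push_cast
    ring
  refine ⟨PositiveLinearMap.mk₀ G₀ fun x hx => ?_, ?_, ?_⟩
  · rw [hG x (.of_nonneg hx)]
    exact_mod_cast hφpos x hx
  · exact (hG 1 (.one E)).trans (by rw [hφone, Complex.ofReal_one])
  · exact (hG h (.of_nonneg hpos)).trans (by rw [hφh])

/-- Every nonzero element of a C*-algebra is normed by a unit vector in some representation. -/
theorem CStarAlgebra.exists_norming_representation.{u} {A : Type u} [NonUnitalCStarAlgebra A]
    {a : A} (ha : a ≠ 0) :
    ∃ (H : Type u) (_ : NormedAddCommGroup H) (_ : InnerProductSpace ℂ H) (_ : CompleteSpace H)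
      (π : A →⋆ₙₐ[ℂ] (H →L[ℂ] H)) (ξ : H), ‖ξ‖ = 1 ∧ ‖π a ξ‖ = ‖a‖ := by
  let _ := CStarAlgebra.spectralOrder (Unitization ℂ A)
  let _ := CStarAlgebra.spectralOrderedRing (Unitization ℂ A)
  set b : Unitization ℂ A := (a : Unitization ℂ A) with hb
  have hbn : ‖b‖ = ‖a‖ := Unitization.norm_inr a
  have hb0 : b ≠ 0 := norm_ne_zero_iff.1 (by rw [hbn]; exact norm_ne_zero_iff.2 ha)
  -- In the GNS space of a state norming `b*b`, the vector of `1` is a unit vector and `π(b)` sends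
  -- it to a vector of squared norm `G(b*b) = ‖b‖²`.
  obtain ⟨G, hG1, hGb⟩ := CStarAlgebra.exists_state_apply_eq_norm (star_mul_self_nonneg b)
    (by rwa [Ne, CStarRing.star_mul_self_eq_zero_iff])
  have hnorm : ∀ x : Unitization ℂ A, ∀ r : ℝ, 0 ≤ r → G (star x * x) = (r ^ 2 : ℝ) →
      ‖G.toPreGNS x‖ = r := by
    intro x r hr h
    have h1 := G.preGNS_norm_sq (G.toPreGNS x)
    rw [G.ofPreGNS_toPreGNS, h] at h1
    exact (pow_left_inj₀ (norm_nonneg _) hr two_ne_zero).1 (by exact_mod_cast h1)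
  refine ⟨G.GNS, inferInstance, inferInstance, inferInstance,
    G.gnsNonUnitalStarAlgHom.comp (Unitization.inrNonUnitalStarAlgHom ℂ A),
    ((G.toPreGNS 1 : G.PreGNS) : G.GNS), ?_, ?_⟩
  · rw [UniformSpace.Completion.norm_coe]
    exact hnorm 1 1 zero_le_one (by simp [hG1])
  · change ‖G.gnsNonUnitalStarAlgHom b _‖ = _
    rw [G.gnsNonUnitalStarAlgHom_apply_coe, UniformSpace.Completion.norm_coe,
      G.leftMulMapPreGNS_apply, G.ofPreGNS_toPreGNS]
    refine hnorm _ _ (norm_nonneg a) ?_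
    simp only [mul_one]
    rw [hGb, CStarRing.norm_star_mul_self, hbn, sq]

end State

theorem CStarSeminorm.le_sup {D : Type*} [NonUnitalRing D] [Module ℂ D] [StarRing D]
    {S : Set (CStarSeminorm D)} (hS : ∀ x, ∃ M : ℝ, ∀ p ∈ S, p x ≤ M) {p : CStarSeminorm D}
    (hp : p ∈ S) (x : D) : p x ≤ CStarSeminorm.sup S hS x := by
  obtain ⟨M, hM⟩ := hS x
  rw [CStarSeminorm.sup_apply]
  exact le_ciSup (f := fun p : S => p.1 x) ⟨M, by rintro _ ⟨p, rfl⟩; exact hM p.1 p.2⟩ ⟨p, hp⟩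

/-! ### The minimal tensor norm is a cross norm -/

section MinNorm

open CStarTensor

variable {H K : Type*} [NormedAddCommGroup H] [InnerProductSpace ℂ H]
  [NormedAddCommGroup K] [InnerProductSpace ℂ K]

theorem norm_hilbertTmul_apply (S : H →L[ℂ] H) (T : K →L[ℂ] K) (ξ : H) (η : K) :
    ‖hilbertTmul S T (toHilbert (ξ ⊗ₜ η))‖ = ‖S ξ‖ * ‖T η‖ := by
  rw [hilbertTmul_coe, LinearIsometry.norm_map, TensorProduct.mapL_tmul, TensorProduct.norm_tmul]

variable [CompleteSpace H] [CompleteSpace K]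

/-- The vector functional `a ↦ ⟪ξ', π(a) ξ⟫`. -/
noncomputable def vectorFunctional {A : Type*} [NonUnitalCStarAlgebra A]
    (π : A →⋆ₙₐ[ℂ] (H →L[ℂ] H)) (ξ' ξ : H) : A →ₗ[ℂ] ℂ where
  toFun a := inner ℂ ξ' (π a ξ)
  map_add' a b := by simp
  map_smul' c a := by simp

/-- Matrix coefficients of `π ⊗ σ` at product vectors factor through slice maps `A ⊙ B → B`, which
reduces definiteness of the minimal norm to the factors. -/
theorem inner_tensorRep {A B : Type*} [NonUnitalCStarAlgebra A] [NonUnitalCStarAlgebra B]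
    (π : A →⋆ₙₐ[ℂ] (H →L[ℂ] H)) (σ : B →⋆ₙₐ[ℂ] (K →L[ℂ] K)) (ξ' ξ : H) (η' η : K)
    (x : A ⊗[ℂ] B) :
    inner ℂ (toHilbert (ξ' ⊗ₜ[ℂ] η')) (tensorRep π σ x (toHilbert (ξ ⊗ₜ[ℂ] η))) =
      inner ℂ η' (σ (TensorProduct.lid ℂ B ((vectorFunctional π ξ' ξ).rTensor B x)) η) := by
  induction x using TensorProduct.induction_on with
  | zero => simp
  | add x y hx hy => simp [hx, hy]
  | tmul a b =>
    rw [tensorRep_tmul, hilbertTmul_coe, LinearIsometry.inner_map_map, TensorProduct.mapL_tmul,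
      TensorProduct.inner_tmul, LinearMap.rTensor_tmul, TensorProduct.lid_tmul, map_smul,
      smul_apply, inner_smul_right]
    rfl

variable {A B : Type*} [NonUnitalCStarAlgebra A] [NonUnitalCStarAlgebra B]

/-- Functionals separating the points of a factor separate the points of the tensor product. -/
theorem TensorProduct.eq_zero_of_rTensor_eq_zero (Ω : Set (A →ₗ[ℂ] ℂ))
    (hΩ : ∀ a, (∀ ω ∈ Ω, ω a = 0) → a = 0) {x : A ⊗[ℂ] B}
    (hx : ∀ ω ∈ Ω, TensorProduct.lid ℂ B (ω.rTensor B x) = 0) : x = 0 := by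
  classical
  -- Over a basis of `B` a tensor has coordinates in `A`, and slicing by `ω` applies `ω` to each of
  -- them.
  let b := Module.Basis.ofVectorSpace ℂ B
  let e := TensorProduct.equivFinsuppOfBasisRight (M := A) b
  have key : ∀ (ω : A →ₗ[ℂ] ℂ) (y : A ⊗[ℂ] B) i,
      b.repr (TensorProduct.lid ℂ B (ω.rTensor B y)) i = ω (e y i) := by
    intro ω y i
    induction y using TensorProduct.induction_on with
    | zero => simp
    | add y z hy hz => simp [hy, hz]
    | tmul a c => simp [e, mul_comm]
  refine e.map_eq_zero_iff.1 (Finsupp.ext fun i => hΩ _ fun ω hω => ?_)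
  rw [← key, hx ω hω]
  simp

theorem norm_tensorRep_le_minTensorNorm.{u, v} {A : Type u} {B : Type v} [NonUnitalCStarAlgebra A]
    [NonUnitalCStarAlgebra B] {H : Type u} {K : Type v} [NormedAddCommGroup H]
    [InnerProductSpace ℂ H] [CompleteSpace H] [NormedAddCommGroup K] [InnerProductSpace ℂ K]
    [CompleteSpace K] (π : A →⋆ₙₐ[ℂ] (H →L[ℂ] H)) (σ : B →⋆ₙₐ[ℂ] (K →L[ℂ] K)) (x : A ⊗[ℂ] B) :
    ‖tensorRep π σ x‖ ≤ minTensorNorm A B x := by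
  unfold minTensorNorm
  refine CStarSeminorm.le_sup (seminorm_bounded _)
    (p := CStarSeminorm.ofHom (tensorRep π σ)) ?_ x
  exact ⟨H, _, _, _, K, _, _, _, π, σ, rfl⟩

/-- The lower bound is tested on `ξ ⊗ η`, where `ξ` norms `a` and `η` norms `b`. -/
theorem minTensorNorm_tmul (a : A) (b : B) : minTensorNorm A B (a ⊗ₜ b) = ‖a‖ * ‖b‖ := by
  refine le_antisymm (seminorm_tmul_le _ a b) ?_
  rcases eq_or_ne a 0 with rfl | ha
  · simp
  rcases eq_or_ne b 0 with rfl | hb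
  · simp
  obtain ⟨H, _, _, _, π, ξ, hξ, hπ⟩ := CStarAlgebra.exists_norming_representation ha
  obtain ⟨K, _, _, _, σ, η, hη, hσ⟩ := CStarAlgebra.exists_norming_representation hb
  refine le_trans ?_ (norm_tensorRep_le_minTensorNorm π σ (a ⊗ₜ b))
  have h := (tensorRep π σ (a ⊗ₜ b)).le_opNorm (toHilbert (ξ ⊗ₜ η))
  rw [tensorRep_tmul, norm_hilbertTmul_apply, hπ, hσ, LinearIsometry.norm_map,
    TensorProduct.norm_tmul, hξ, hη, mul_one, mul_one] at h
  exact h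

/-- Vector functionals separate the points of `A`, so it suffices that they slice `x` to zero; a
nonzero slice would be detected by some representation `σ` of `B`. -/
theorem eq_zero_of_minTensorNorm_eq_zero {x : A ⊗[ℂ] B} (hx : minTensorNorm A B x = 0) :
    x = 0 := by
  refine TensorProduct.eq_zero_of_rTensor_eq_zero
    {ω | ∃ (H : Type _) (_ : NormedAddCommGroup H) (_ : InnerProductSpace ℂ H)
      (_ : CompleteSpace H) (π : A →⋆ₙₐ[ℂ] (H →L[ℂ] H)) (ξ' ξ : H), ω = vectorFunctional π ξ' ξ}
    (fun a h => ?_) ?_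
  · by_contra ha
    obtain ⟨H, _, _, _, π, ξ, -, hπ⟩ := CStarAlgebra.exists_norming_representation ha
    have h1 : inner ℂ (π a ξ) (π a ξ) = 0 := h _ ⟨H, _, _, _, π, π a ξ, ξ, rfl⟩
    rw [inner_self_eq_zero] at h1
    rw [h1, norm_zero] at hπ
    exact ha (norm_eq_zero.1 hπ.symm)
  · rintro _ ⟨H, _, _, _, π, ξ', ξ, rfl⟩
    by_contra hy
    obtain ⟨K, _, _, _, σ, η, -, hσ⟩ := CStarAlgebra.exists_norming_representation hy
    have h0 : tensorRep π σ x = 0 :=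
      norm_le_zero_iff.1 ((norm_tensorRep_le_minTensorNorm π σ x).trans hx.le)
    -- With `y` the slice, pairing with `σ(y)η` turns the coefficient into `‖σ(y)η‖²`.
    have h1 := inner_tensorRep π σ ξ' ξ
      (σ (TensorProduct.lid ℂ B ((vectorFunctional π ξ' ξ).rTensor B x)) η) η x
    rw [h0, zero_apply, inner_zero_right, eq_comm, inner_self_eq_zero] at h1
    rw [h1, norm_zero] at hσ
    exact hy (norm_eq_zero.1 hσ.symm)

variable (A B) in
/-- The minimal tensor norm, as a C*-cross-norm. -/
noncomputable def minCrossNorm : CStarCrossNorm A B where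
  toCStarSeminorm := minTensorNorm A B
  eq_zero_of_apply_eq_zero _ := eq_zero_of_minTensorNorm_eq_zero
  apply_tmul := minTensorNorm_tmul

theorem maxTensorNorm_tmul (a : A) (b : B) : maxTensorNorm A B (a ⊗ₜ b) = ‖a‖ * ‖b‖ :=
  le_antisymm (seminorm_tmul_le _ a b)
    ((minTensorNorm_tmul a b).symm.le.trans (CStarSeminorm.le_sup (seminorm_bounded _) (Set.mem_univ _) _))

end MinNorm

/-- Softness of C*-algebraic tensor products. -/
theorem mainTheorem12 (A B : Type*) [NonUnitalCStarAlgebra A] [NonUnitalCStarAlgebra B] :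
    List.TFAE
      [IsSoft A ∨ IsSoft B,
       IsSoft (MaxTensorProduct A B),
       ∃ ϱ : CStarCrossNorm A B, IsSoft ϱ.TensorProduct,
       ∀ ϱ : CStarCrossNorm A B, IsSoft ϱ.TensorProduct,
       IsSoft (MinTensorProduct A B)] := by
  tfae_have 1 → 2 := (maxTensorNorm A B).isSoft_completion
  tfae_have 2 → 1 := (maxTensorNorm A B).isSoft_or_isSoft maxTensorNorm_tmul
  tfae_have 1 → 4 := fun h ϱ => ϱ.toCStarSeminorm.isSoft_completion h
  tfae_have 4 → 5 := fun h => h (minCrossNorm A B)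
  tfae_have 5 → 3 := fun h => ⟨minCrossNorm A B, h⟩
  tfae_have 3 → 1 := fun ⟨ϱ, h⟩ => ϱ.toCStarSeminorm.isSoft_or_isSoft ϱ.apply_tmul h
  tfae_finish
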